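/- For $\alpha\in(0,\pi)$ let $\mathcal W_\alpha=\{(x_1,x_2,x_3)\in\mathbb R^3:\ |x_2|\le x_1\tan\frac{\alpha}{2}\}$ be the infinite wedge of opening $\alpha$. For a constant magnetic field $\mathbf B=(b_1,b_2,b_3)$ let $E(\mathbf B,\mathcal W_\alpha)$ be the bottom of the spectrum of the magnetic Laplacian $(-i\nabla-\mathbf A)^2$ on $L^2(\mathcal W_\alpha)$ with its natural Neumann boundary condition, i.e. of the self-adjoint operator associated with the quadratic form $u\mapsto\int_{\mathcal W_\alpha}|(-i\nabla-\mathbf A)u|^2\,dx$ on $\{u\in L^2(\mathcal W_\alpha):\ (-i\nabla-\mathbf A)u\in L^2(\mathcal W_\alpha)\}$, where $\mathbf A$ is any linear potential with $\operatorname{curl}\mathbf A=\mathbf B$ (the value does not depend on the choice of $\mathbf A$). For $\tau\in\mathbb R$ let $\zeta(\tau)$ be the first eigenvalue of the operator $-\frac1r\partial_r r\partial_r+(r-\tau)^2$ on $L^2((0,\infty),r\,dr)$, i.e. of the self-adjoint operator associated with the quadratic form $u\mapsto\int_0^\infty\big(|u'(r)|^2+(r-\tau)^2|u(r)|^2\big)\,r\,dr$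 on $\{u:\ u,\ u',\ ru\in L^2((0,\infty),r\,dr)\}$, and let $\Xi_0:=\inf_{\tau\in\mathbb R}\zeta(\tau)$. **Proposition 5.2.** Let $\mathbf B=(b_1,b_2,b_3)\in\mathbb R^3$ with $|\mathbf B|=1$ and $b_2>0$. There exists a constant $C(\mathbf B)>0$ such that $$\forall \alpha\in(0,\pi),\qquad E(\mathbf B,\mathcal W_\alpha)\le b_2\,\Xi_0+C(\mathbf B)\,\alpha^2 .$$ -/

import Mathlib

open MeasureTheory Set
open scoped ContDiff

noncomputable section

namespace WedgeMagnetic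

/-! ### Operators associated with quadratic forms, and their spectrum -/

section Abstract

variable {H K : Type*} [NormedAddCommGroup H] [InnerProductSpace ℂ H]
  [NormedAddCommGroup K] [InnerProductSpace ℂ K]

/-- `D` is (the graph of) a linear map from a subspace of `H` to `K`. It carries the quadratic form
`q u = ‖D u‖²` with form domain `Dom D`. `FormOperator D u f` says that `u` belongs to the domain
of the operator `T` associated with `q` and that `T u = f`, that is: `u ∈ Dom D` and
`⟪D v, D u⟫ = ⟪v, f⟫` for every `v ∈ Dom D`. -/
def FormOperator (D : H → K → Prop) (u f : H) : Prop :=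
  ∃ w : K, D u w ∧ ∀ (v : H) (z : K), D v z → inner ℂ z w = inner ℂ v f

/-- `z` is in the resolvent set of the (unbounded) operator with graph `T`: the operator `T - z`
is a bijection from its domain onto `H` with a bounded inverse `R`.
(`T u (f + z • u)` reads `(T - z) u = f`.) -/
def IsResolventPoint (T : H → H → Prop) (z : ℂ) : Prop :=
  ∃ R : H →L[ℂ] H, ∀ u f : H, T u (f + z • u) ↔ u = R f

/-- The spectrum of the (unbounded) operator with graph `T`. -/
def operatorSpectrum (T : H → H → Prop) : Set ℂ :=
  {z | ¬ IsResolventPoint T z}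

/-- The bottom of the spectrum of a self-adjoint operator (whose spectrum is real), as an infimum
of extended reals. -/
def bottomOfSpectrum (T : H → H → Prop) : EReal :=
  ⨅ (t : ℝ) (_ : (t : ℂ) ∈ operatorSpectrum T), (t : EReal)

/-- `t` is an eigenvalue of the (unbounded) operator with graph `T`. -/
def IsEigenvalue (T : H → H → Prop) (t : ℝ) : Prop :=
  ∃ u : H, u ≠ 0 ∧ T u ((t : ℂ) • u)

/-- The first (lowest) eigenvalue of a self-adjoint operator. -/
def firstEigenvalue (T : H → H → Prop) : EReal :=
  ⨅ (t : ℝ) (_ : IsEigenvalue T t), (t : EReal)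

end Abstract

/-! ### The magnetic Laplacian with natural Neumann condition on an open set of `ℝ³` -/

/-- Euclidean space `ℝ³`; the coordinates `x₁, x₂, x₃` are `x 0, x 1, x 2`. -/
abbrev E3 : Type := EuclideanSpace ℝ (Fin 3)

/-- The partial derivative `∂ⱼ F`. -/
def partialDeriv {G : Type*} [NormedAddCommGroup G] [NormedSpace ℝ G]
    (j : Fin 3) (F : E3 → G) (x : E3) : G :=
  fderiv ℝ F x (EuclideanSpace.single j 1)

/-- The curl of a vector field on `ℝ³`. -/
def curl (A : E3 → E3) (x : E3) : E3 :=
  !₂[partialDeriv 1 A x 2 - partialDeriv 2 A x 1,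
     partialDeriv 2 A x 0 - partialDeriv 0 A x 2,
     partialDeriv 0 A x 1 - partialDeriv 1 A x 0]

/-- The complex Hilbert space `L²(U)`. -/
abbrev L2 (U : Set E3) : Type := Lp ℂ 2 (volume.restrict U)

/-- `w = (-i∇ - A) u` in the sense of distributions on the open set `U`, with `u ∈ L²(U)` and
`w ∈ L²(U)³`: for all test functions `φ ∈ C_c^∞(U)` and all `j`,
`∫_U u (i ∂ⱼφ - Aⱼ φ) = ∫_U wⱼ φ`. -/
def IsMagneticGradient (A : E3 → E3) (U : Set E3) (u : L2 U)
    (w : PiLp 2 (fun _ : Fin 3 => L2 U)) : Prop :=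
  ∀ φ : E3 → ℂ, ContDiff ℝ ∞ φ → HasCompactSupport φ → tsupport φ ⊆ U → ∀ j : Fin 3,
    ∫ x in U, u x * (Complex.I * partialDeriv j φ x - ((A x j : ℝ) : ℂ) * φ x)
      = ∫ x in U, w j x * φ x

/-- The magnetic Laplacian `(-i∇ - A)²` on `U` with natural Neumann boundary condition: the operator
associated with the form `∫_U |(-i∇ - A) u|²` on `{u ∈ L²(U) : (-i∇ - A) u ∈ L²(U)}`. -/
def MagneticLaplacian (A : E3 → E3) (U : Set E3) : L2 U → L2 U → Prop :=
  FormOperator (IsMagneticGradient A U)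

/-- The (interior of the) wedge of opening `α ∈ (0, π)` around the `x₃`-axis. -/
def wedge (α : ℝ) : Set E3 :=
  {x | |x 1| < x 0 * Real.tan (α / 2)}

/-- The ground energy of the magnetic Laplacian with potential `A` on the wedge of opening `α`. -/
def groundEnergy (A : E3 → E3) (α : ℝ) : EReal :=
  bottomOfSpectrum (MagneticLaplacian A (wedge α))

/-! ### The weighted operator on the half-line -/

/-- The measure `r dr` on `(0, ∞)`. -/
def radialMeasure : Measure ℝ :=
  (volume.restrict (Ioi (0 : ℝ))).withDensity (fun r => ENNReal.ofReal r)

/-- The complex Hilbert space `L²((0, ∞), r dr)`. -/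
abbrev L2r : Type := Lp ℂ 2 radialMeasure

/-- `g` is the distributional derivative of `u` on `(0, ∞)`. -/
def IsWeakDeriv (u g : L2r) : Prop :=
  ∀ φ : ℝ → ℂ, ContDiff ℝ ∞ φ → HasCompactSupport φ → tsupport φ ⊆ Ioi (0 : ℝ) →
    ∫ r in Ioi (0 : ℝ), u r * deriv φ r = - ∫ r in Ioi (0 : ℝ), g r * φ r

/-- `w = (u', (r - τ) u)`, with `u`, `u'` and `(r - τ) u` in `L²(r dr)`. As `u ∈ L²(r dr)`, the last
condition is the same as `r u ∈ L²(r dr)`. -/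
def IsRadialGradient (τ : ℝ) (u : L2r) (w : PiLp 2 (fun _ : Fin 2 => L2r)) : Prop :=
  IsWeakDeriv u (w 0) ∧ ∀ᵐ r ∂radialMeasure, w 1 r = ((r - τ : ℝ) : ℂ) * u r

/-- The operator `-(1/r) ∂ᵣ r ∂ᵣ + (r - τ)²` in `L²(r dr)`, associated with the form
`∫ (|u'|² + (r - τ)² |u|²) r dr` on `{u : u, u', r u ∈ L²(r dr)}`. -/
def RadialOperator (τ : ℝ) : L2r → L2r → Prop :=
  FormOperator (IsRadialGradient τ)

/-- `ζ(τ)`, the first eigenvalue. -/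
def zeta (τ : ℝ) : EReal := firstEigenvalue (RadialOperator τ)

/-- `Ξ₀ = inf_τ ζ(τ)`. -/
def Xi0 : EReal := ⨅ τ : ℝ, zeta τ

end WedgeMagnetic

end

/-! The bottom of the spectrum lies below every Rayleigh quotient. In the gauge
`A = (-b₃ x₂, 0, b₁ x₂ - b₂ x₁ - k)` the real trial function `f (√b₂ x₁) χ (x₃)`, with `χ` spread
out, has a quotient equal to `b₂` times that of `f` for the radial form with `τ = -k / √b₂`, up to
an error `O(tan² (α / 2))` times the second moment of `f` and a term that vanishes in the limit.
The weight `r dr` of the radial form is the width of the sector `|x₂| < x₁ tan (α / 2)` at `x₁ = r`,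
up to a constant factor.

What remains is to bound the moments uniformly as the radial energy approaches `Ξ₀`. An explicit
trial function shows that `Ξ₀ < 1`, whereas below any level `l < 1` the parameter `τ` stays bounded,
because `ζ(τ) → 1` as `τ → ∞`, and then the form controls the second moment. -/

noncomputable section

namespace WedgeMagnetic

section FormOperator

variable {H K : Type*} [NormedAddCommGroup H] [InnerProductSpace ℂ H]
  [NormedAddCommGroup K] [InnerProductSpace ℂ K]

/-- The projection of a graph to its first component, whose adjoint solves the weak equation of
the operator associated with a form. -/
def graphFst (G : Submodule ℂ (WithLp 2 (H × K))) : G →L[ℂ] H :=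
  (WithLp.fstL 2 ℂ H K).comp G.subtypeL

lemma graphFst_apply (G : Submodule ℂ (WithLp 2 (H × K))) (x : G) :
    graphFst G x = (x : WithLp 2 (H × K)).fst := rfl

/-- A resolvent point `t ≠ -1` of `T` is turned into the resolvent point `(1 + t)⁻¹` of
`R = (T + 1)⁻¹`. -/
lemma isUnit_algebraMap_sub_of_isResolventPoint {T : H → H → Prop} {R : H →L[ℂ] H}
    (hR : ∀ u f, T u (f - u) ↔ u = R f) {t : ℂ} (ht : 1 + t ≠ 0) (h : IsResolventPoint T t) :
    IsUnit (algebraMap ℂ (H →L[ℂ] H) (1 + t)⁻¹ - R) := by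
  obtain ⟨S, hS⟩ := h
  have hSR : ∀ f, S f = R f + (1 + t) • R (S f) := fun f => by
    have hT := (hS (S f) f).2 rfl
    rwa [show f + t • S f = (f + (1 + t) • S f) - S f by module, hR, map_add, map_smul] at hT
  have hRS : ∀ f, R f = S f - (1 + t) • S (R f) := fun f => by
    have hT := (hR (R f) f).2 rfl
    rwa [show f - R f = (f - (1 + t) • R f) + t • R f by module, hS, map_sub, map_smul] at hT
  refine ⟨⟨algebraMap ℂ (H →L[ℂ] H) (1 + t)⁻¹ - R, (1 + t) • (1 + (1 + t) • S), ?_, ?_⟩, rfl⟩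
  · ext f
    simp only [mul_apply_eq_comp, sub_apply, smul_apply, add_apply, one_apply_eq_self,
      Algebra.algebraMap_eq_smul_one, map_smul, map_add, smul_sub, smul_add, smul_smul, mul_assoc,
      mul_inv_cancel₀ ht, mul_one, one_smul]
    linear_combination (norm := module) (1 + t) • hSR f
  · ext f
    simp only [mul_apply_eq_comp, sub_apply, smul_apply, add_apply, one_apply_eq_self,
      Algebra.algebraMap_eq_smul_one, map_smul, map_sub, smul_add, smul_smul,
      inv_mul_cancel₀ ht, inv_mul_cancel_left₀ ht, one_smul]
    linear_combination (norm := module) (-(1 + t)) • hRS f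

variable [CompleteSpace H]

lemma formOperator_sub_iff {D : H → K → Prop} (G : Submodule ℂ (WithLp 2 (H × K)))
    [CompleteSpace G] (hG : ∀ u w, D u w ↔ WithLp.toLp 2 (u, w) ∈ G) (u f : H) :
    FormOperator D u (f - u) ↔ u = (graphFst G ∘L (graphFst G).adjoint) f := by
  have hinner : ∀ x y : G, inner ℂ x y
      = inner ℂ (x : WithLp 2 (H × K)).fst (y : WithLp 2 (H × K)).fst
        + inner ℂ (x : WithLp 2 (H × K)).snd (y : WithLp 2 (H × K)).snd := fun x y =>
    (Submodule.coe_inner _ x y).trans (WithLp.prod_inner_apply _ _)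
  constructor
  · rintro ⟨w, hw, h⟩
    have hx : (⟨WithLp.toLp 2 (u, w), (hG u w).1 hw⟩ : G) = (graphFst G).adjoint f := by
      refine ext_inner_left ℂ fun y => ?_
      rw [ContinuousLinearMap.adjoint_inner_right, graphFst_apply, hinner]
      have hy := h (y : WithLp 2 (H × K)).fst (y : WithLp 2 (H × K)).snd ((hG _ _).2 y.2)
      change inner ℂ (y : WithLp 2 (H × K)).fst u + inner ℂ (y : WithLp 2 (H × K)).snd w = _
      rw [hy, inner_sub_right, add_sub_cancel]
    exact congrArg (graphFst G) hx
  · intro hu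
    refine ⟨((graphFst G).adjoint f : WithLp 2 (H × K)).snd, ?_, fun v z hv => ?_⟩
    · rw [hG, hu]
      exact ((graphFst G).adjoint f).2
    · have hweak := hinner ⟨WithLp.toLp 2 (v, z), (hG v z).1 hv⟩ ((graphFst G).adjoint f)
      rw [ContinuousLinearMap.adjoint_inner_right] at hweak
      change inner ℂ v f = inner ℂ v (graphFst G ((graphFst G).adjoint f))
        + inner ℂ z ((graphFst G).adjoint f : WithLp 2 (H × K)).snd at hweak
      rw [inner_sub_right, hweak, hu, ContinuousLinearMap.comp_apply, add_sub_cancel_left]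

/-- The top `‖R‖` of the spectrum of `R = (T + 1)⁻¹` corresponds to the bottom of the spectrum of
`T`. -/
lemma inv_norm_sub_one_mem_operatorSpectrum [Nontrivial H] {T : H → H → Prop} {R : H →L[ℂ] H}
    (hR : ∀ u f, T u (f - u) ↔ u = R f) (hpos : 0 ≤ R) (hne : R ≠ 0) :
    ((‖R‖⁻¹ - 1 : ℝ) : ℂ) ∈ operatorSpectrum T := by
  intro hres
  have hmem : ((‖R‖ : ℝ) : ℂ) ∈ spectrum ℂ R :=
    spectrum.algebraMap_mem ℂ (CStarAlgebra.norm_mem_spectrum_of_nonneg hpos)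
  have hinv : (1 : ℂ) + ((‖R‖⁻¹ - 1 : ℝ) : ℂ) = ((‖R‖ : ℝ) : ℂ)⁻¹ := by push_cast; ring
  have hunit := isUnit_algebraMap_sub_of_isResolventPoint hR
    (by rw [hinv]; exact inv_ne_zero (by exact_mod_cast norm_ne_zero_iff.2 hne)) hres
  rw [hinv, inv_inv] at hunit
  exact hmem hunit

lemma norm_sq_le_norm_comp_adjoint_mul (G : Submodule ℂ (WithLp 2 (H × K))) [CompleteSpace G]
    {u : H} {w : K} (h : WithLp.toLp 2 (u, w) ∈ G) :
    ‖u‖ ^ 2 ≤ ‖graphFst G ∘L (graphFst G).adjoint‖ * (‖u‖ ^ 2 + ‖w‖ ^ 2) := by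
  have hnorm := ContinuousLinearMap.norm_adjoint_comp_self (graphFst G).adjoint
  rw [ContinuousLinearMap.adjoint_adjoint, LinearIsometryEquiv.norm_map] at hnorm
  set x : G := ⟨WithLp.toLp 2 (u, w), h⟩
  have hx : ‖x‖ ^ 2 = ‖u‖ ^ 2 + ‖w‖ ^ 2 := WithLp.prod_norm_sq_eq_of_L2 _
  calc ‖u‖ ^ 2 ≤ (‖graphFst G‖ * ‖x‖) ^ 2 := by gcongr; exact (graphFst G).le_opNorm x
    _ = _ := by rw [hnorm, ← hx]; ring

theorem bottomOfSpectrum_le_rayleigh [CompleteSpace K] {D : H → K → Prop}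
    (G : Submodule ℂ (WithLp 2 (H × K))) (hGc : IsClosed (G : Set (WithLp 2 (H × K))))
    (hG : ∀ u w, D u w ↔ WithLp.toLp 2 (u, w) ∈ G) {u : H} {w : K} (hu : u ≠ 0) (huw : D u w) :
    bottomOfSpectrum (FormOperator D) ≤ ((‖w‖ ^ 2 / ‖u‖ ^ 2 : ℝ) : EReal) := by
  have : CompleteSpace G := hGc.completeSpace_coe
  have : Nontrivial H := ⟨u, 0, hu⟩
  set R := graphFst G ∘L (graphFst G).adjoint
  have hu0 : 0 < ‖u‖ := norm_pos_iff.2 hu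
  have hle : ‖u‖ ^ 2 ≤ ‖R‖ * (‖u‖ ^ 2 + ‖w‖ ^ 2) :=
    norm_sq_le_norm_comp_adjoint_mul G ((hG u w).1 huw)
  have hRpos : 0 ≤ R :=
    (ContinuousLinearMap.nonneg_iff_isPositive _).2
      (ContinuousLinearMap.isPositive_self_comp_adjoint _)
  have hRne : R ≠ 0 := fun h => by
    rw [h, norm_zero, zero_mul] at hle
    nlinarith
  have hspec := inv_norm_sub_one_mem_operatorSpectrum (formOperator_sub_iff G hG) hRpos hRne
  refine (iInf₂_le (f := fun (t : ℝ) (_ : (t : ℂ) ∈ operatorSpectrum (FormOperator D)) =>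
    (t : EReal)) _ hspec).trans ?_
  rw [EReal.coe_le_coe_iff, le_div_iff₀ (by positivity)]
  have := (inv_mul_le_iff₀ (norm_pos_iff.2 hRne)).2 hle
  linarith

end FormOperator

section Lp

variable {X : Type*} [MeasurableSpace X] {μ : Measure X}

lemma exists_clm_eq_integral_mul {a : X → ℂ} (ha : MemLp a 2 μ) :
    ∃ l : Lp ℂ 2 μ →L[ℂ] ℂ, ∀ u, l u = ∫ x, u x * a x ∂μ := by
  have hconj : MemLp (fun x => starRingEnd ℂ (a x)) 2 μ := ha.star
  refine ⟨innerSL ℂ (hconj.toLp _), fun u => ?_⟩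
  rw [innerSL_apply_apply, L2.inner_def]
  refine integral_congr_ae ?_
  filter_upwards [hconj.coeFn_toLp] with x hx
  rw [hx, RCLike.inner_apply, Complex.conj_conj]

lemma norm_toLp_sq {E : Type*} [NormedAddCommGroup E] [InnerProductSpace ℂ E] {f : X → E}
    (hf : MemLp f 2 μ) : ‖hf.toLp f‖ ^ 2 = ∫ x, ‖f x‖ ^ 2 ∂μ := by
  rw [← @inner_self_eq_norm_sq ℂ, L2.inner_def, ← integral_re (L2.integrable_inner _ _)]
  refine integral_congr_ae ?_
  filter_upwards [hf.coeFn_toLp] with x hx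
  rw [hx, inner_self_eq_norm_sq]

lemma setIntegral_toLp_mul {U : Set X} {f g : X → ℂ} (hf : MemLp f 2 (μ.restrict U))
    (hg : ∀ x ∉ U, g x = 0) : ∫ x in U, hf.toLp f x * g x ∂μ = ∫ x, f x * g x ∂μ := by
  rw [← setIntegral_eq_integral_of_forall_compl_eq_zero (s := U) (f := fun x => f x * g x)
    fun x hx => by rw [hg x hx, mul_zero]]
  refine integral_congr_ae ?_
  filter_upwards [hf.coeFn_toLp] with x hx
  rw [hx]

lemma memLp_of_continuous_of_ae_eq_zero_off_compact {Y E : Type*} [TopologicalSpace Y] [T2Space Y]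
    [MeasurableSpace Y] [BorelSpace Y] [NormedAddCommGroup E] [SecondCountableTopologyEither Y E]
    {ν : Measure Y} [IsFiniteMeasureOnCompacts ν] {F : Y → E} {K : Set Y} (hF : Continuous F)
    (hK : IsCompact K) (h0 : ∀ᵐ y ∂ν, y ∉ K → F y = 0) (p : ENNReal) : MemLp F p ν := by
  obtain ⟨C, hC⟩ := hK.exists_bound_of_continuousOn hF.continuousOn
  have : IsFiniteMeasure (ν.restrict K) :=
    ⟨by rw [Measure.restrict_apply_univ]; exact hK.measure_lt_top⟩
  have hFK : MemLp F p (ν.restrict K) := MemLp.of_bound hF.aestronglyMeasurable C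
    ((ae_restrict_iff' hK.measurableSet).2 (.of_forall hC))
  refine ((memLp_indicator_iff_restrict hK.measurableSet).2 hFK).ae_eq ?_
  filter_upwards [h0] with y hy
  by_cases hyK : y ∈ K
  · rw [indicator_of_mem hyK]
  · rw [indicator_of_notMem hyK, hy hyK]

end Lp

section PartialDeriv

lemma continuous_partialDeriv {G : Type*} [NormedAddCommGroup G] [NormedSpace ℝ G] {φ : E3 → G}
    (hφ : ContDiff ℝ 1 φ) (j : Fin 3) : Continuous (partialDeriv j φ) :=
  (hφ.continuous_fderiv one_ne_zero).clm_apply continuous_const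

lemma partialDeriv_eq_zero_of_notMem_tsupport {G : Type*} [NormedAddCommGroup G]
    [NormedSpace ℝ G] {φ : E3 → G} {x : E3} (hx : x ∉ tsupport φ) (j : Fin 3) :
    partialDeriv j φ x = 0 :=
  image_eq_zero_of_notMem_tsupport fun h =>
    hx (tsupport_fderiv_apply_subset ℝ (EuclideanSpace.single j (1 : ℝ)) h)

lemma continuous_coord (j : Fin 3) : Continuous fun x : E3 => x j :=
  (EuclideanSpace.proj (𝕜 := ℝ) j).continuous

lemma continuous_ofReal_coord {A : E3 → E3} (hA : Continuous A) (j : Fin 3) :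
    Continuous fun x => ((A x j : ℝ) : ℂ) :=
  Complex.continuous_ofReal.comp ((continuous_coord j).comp hA)

end PartialDeriv

section MagneticGradient

lemma exists_closed_graph_isMagneticGradient {A : E3 → E3} (hA : Continuous A) (U : Set E3) :
    ∃ G : Submodule ℂ (WithLp 2 (L2 U × PiLp 2 (fun _ : Fin 3 => L2 U))),
      IsClosed (G : Set (WithLp 2 (L2 U × PiLp 2 (fun _ : Fin 3 => L2 U)))) ∧
      ∀ u w, IsMagneticGradient A U u w ↔ WithLp.toLp 2 (u, w) ∈ G := by
  let I := {φ : E3 → ℂ // ContDiff ℝ ∞ φ ∧ HasCompactSupport φ ∧ tsupport φ ⊆ U} × Fin 3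
  have hdual : ∀ i : I, MemLp (fun x => Complex.I * partialDeriv i.2 i.1.1 x
      - ((A x i.2 : ℝ) : ℂ) * i.1.1 x) 2 (volume.restrict U) := fun ⟨⟨φ, hφ, hc, _⟩, j⟩ => by
    have hcont : Continuous fun x => Complex.I * partialDeriv j φ x - ((A x j : ℝ) : ℂ) * φ x :=
      (continuous_const.mul (continuous_partialDeriv (hφ.of_le (by simp)) _)).sub
        ((continuous_ofReal_coord hA j).mul hφ.continuous)
    exact (hcont.memLp_of_hasCompactSupport
      ((hc.fderiv_apply (𝕜 := ℝ) _).mul_left.sub hc.mul_left)).restrict U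
  have htest : ∀ i : I, MemLp i.1.1 2 (volume.restrict U) := fun ⟨⟨φ, hφ, hc, _⟩, _⟩ =>
    (hφ.continuous.memLp_of_hasCompactSupport hc).restrict U
  choose l₁ hl₁ using fun i => exists_clm_eq_integral_mul (hdual i)
  choose l₂ hl₂ using fun i => exists_clm_eq_integral_mul (htest i)
  let l : I → WithLp 2 (L2 U × PiLp 2 (fun _ : Fin 3 => L2 U)) →L[ℂ] ℂ := fun i =>
    (l₁ i).comp (WithLp.fstL 2 ℂ _ _) -
      ((l₂ i).comp (PiLp.proj (𝕜 := ℂ) 2 (fun _ : Fin 3 => L2 U) i.2)).comp (WithLp.sndL 2 ℂ _ _)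
  have hker : ∀ i u w, WithLp.toLp 2 (u, w) ∈ (l i).ker ↔ l₁ i u = l₂ i (w i.2) := fun i u w => by
    rw [LinearMap.mem_ker]
    exact sub_eq_zero
  refine ⟨⨅ i, (l i).ker, ?_, fun u w => ?_⟩
  · rw [Submodule.coe_iInf]
    exact isClosed_iInter fun i => (l i).isClosed_ker
  · simp only [Submodule.mem_iInf, hker, hl₁, hl₂]
    exact ⟨fun h i => h i.1.1 i.1.2.1 i.1.2.2.1 i.1.2.2.2 i.2,
      fun h φ hφ hc hs j => h ⟨⟨φ, hφ, hc, hs⟩, j⟩⟩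

lemma integral_mul_magneticGradient {a ψ φ : E3 → ℂ} (ha : Continuous a) (hψ : ContDiff ℝ 1 ψ)
    (hφ : ContDiff ℝ 1 φ) (hc : HasCompactSupport φ) (j : Fin 3) :
    ∫ x, ψ x * (Complex.I * partialDeriv j φ x - a x * φ x)
      = ∫ x, (-Complex.I * partialDeriv j ψ x - a x * ψ x) * φ x := by
  have hint₁ : Integrable (fun x => partialDeriv j ψ x * φ x) :=
    ((continuous_partialDeriv hψ j).mul hφ.continuous).integrable_of_hasCompactSupport hc.mul_left
  have hint₂ : Integrable (fun x => ψ x * partialDeriv j φ x) :=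
    (hψ.continuous.mul (continuous_partialDeriv hφ j)).integrable_of_hasCompactSupport
      (hc.fderiv_apply (𝕜 := ℝ) _).mul_left
  have hint₃ : Integrable (fun x => ψ x * φ x) :=
    (hψ.continuous.mul hφ.continuous).integrable_of_hasCompactSupport hc.mul_left
  have hint₄ : Integrable (fun x => a x * ψ x * φ x) :=
    ((ha.mul hψ.continuous).mul hφ.continuous).integrable_of_hasCompactSupport hc.mul_left
  have hparts : ∫ x, ψ x * partialDeriv j φ x = - ∫ x, partialDeriv j ψ x * φ x :=
    integral_mul_fderiv_eq_neg_fderiv_mul_of_integrable hint₁ hint₂ hint₃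
      (fun x _ => hψ.differentiable one_ne_zero x) (fun x _ => hφ.differentiable one_ne_zero x)
  calc ∫ x, ψ x * (Complex.I * partialDeriv j φ x - a x * φ x)
      = ∫ x, (Complex.I * (ψ x * partialDeriv j φ x) - a x * ψ x * φ x) := by
        congr 1; ext x; ring
    _ = ∫ x, (-Complex.I * (partialDeriv j ψ x * φ x) - a x * ψ x * φ x) := by
        rw [integral_sub (hint₂.const_mul _) hint₄, integral_sub (hint₁.const_mul _) hint₄,
          integral_const_mul, integral_const_mul, hparts]
        ring
    _ = _ := by congr 1; ext x; ring

lemma isMagneticGradient_toLp {A : E3 → E3} (hA : Continuous A) {U : Set E3}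
    {ψ : E3 → ℂ} (hψ : ContDiff ℝ 1 ψ) (h0 : MemLp ψ 2 (volume.restrict U))
    (h1 : ∀ j, MemLp (fun x => -Complex.I * partialDeriv j ψ x - ((A x j : ℝ) : ℂ) * ψ x) 2
      (volume.restrict U)) :
    IsMagneticGradient A U (h0.toLp ψ) (WithLp.toLp 2 fun j => (h1 j).toLp _) := by
  intro φ hφ hc hs j
  have hφU : ∀ x ∉ U, φ x = 0 := fun x hx => image_eq_zero_of_notMem_tsupport fun h => hx (hs h)
  have hdφU : ∀ x ∉ U, partialDeriv j φ x = 0 := fun x hx =>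
    partialDeriv_eq_zero_of_notMem_tsupport (fun h => hx (hs h)) j
  calc ∫ x in U, h0.toLp ψ x * (Complex.I * partialDeriv j φ x - ((A x j : ℝ) : ℂ) * φ x)
      = ∫ x, ψ x * (Complex.I * partialDeriv j φ x - ((A x j : ℝ) : ℂ) * φ x) :=
        setIntegral_toLp_mul h0 fun x hx => by rw [hφU x hx, hdφU x hx]; simp
    _ = ∫ x, (-Complex.I * partialDeriv j ψ x - ((A x j : ℝ) : ℂ) * ψ x) * φ x :=
        integral_mul_magneticGradient (continuous_ofReal_coord hA j) hψ (hφ.of_le (by simp)) hc j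
    _ = ∫ x in U, (h1 j).toLp _ x * φ x := (setIntegral_toLp_mul (h1 j) hφU).symm

lemma isOpen_wedge (α : ℝ) : IsOpen (wedge α) :=
  isOpen_lt (continuous_coord 1).abs ((continuous_coord 0).mul continuous_const)

lemma groundEnergy_le_of_trial {A : E3 → E3} (hA : Continuous A) {α : ℝ}
    {ψ : E3 → ℂ} (hψ : ContDiff ℝ 1 ψ) {K : Set E3} (hK : IsCompact K)
    (h0 : ∀ x ∈ wedge α \ K, ψ x = 0) (hpos : 0 < ∫ x in wedge α, ‖ψ x‖ ^ 2) :
    groundEnergy A α ≤ (((∫ x in wedge α,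
      ∑ j, ‖-Complex.I * partialDeriv j ψ x - ((A x j : ℝ) : ℂ) * ψ x‖ ^ 2)
        / ∫ x in wedge α, ‖ψ x‖ ^ 2 : ℝ) : EReal) := by
  have hU := isOpen_wedge α
  have hd0 : ∀ j, ∀ x ∈ wedge α \ K, partialDeriv j ψ x = 0 := fun j x hx => by
    have hloc : ψ =ᶠ[nhds x] 0 := by
      filter_upwards [(hU.sdiff hK.isClosed).mem_nhds hx] with y hy using h0 y hy
    rw [partialDeriv, hloc.fderiv_eq, fderiv_zero]
    rfl
  have hmem₀ : MemLp ψ 2 (volume.restrict (wedge α)) := by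
    refine memLp_of_continuous_of_ae_eq_zero_off_compact hψ.continuous hK ?_ 2
    filter_upwards [ae_restrict_mem hU.measurableSet] with x hx hxK using h0 x ⟨hx, hxK⟩
  have hmem₁ : ∀ j, MemLp (fun x => -Complex.I * partialDeriv j ψ x - ((A x j : ℝ) : ℂ) * ψ x) 2
      (volume.restrict (wedge α)) := fun j => by
    have hcont : Continuous fun x => -Complex.I * partialDeriv j ψ x - ((A x j : ℝ) : ℂ) * ψ x :=
      (continuous_const.mul (continuous_partialDeriv hψ j)).sub
        ((continuous_ofReal_coord hA j).mul hψ.continuous)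
    refine memLp_of_continuous_of_ae_eq_zero_off_compact hcont hK ?_ 2
    filter_upwards [ae_restrict_mem hU.measurableSet] with x hx hxK
    rw [hd0 j x ⟨hx, hxK⟩, h0 x ⟨hx, hxK⟩, mul_zero, mul_zero, sub_zero]
  obtain ⟨G, hGc, hG⟩ := exists_closed_graph_isMagneticGradient hA (wedge α)
  have hne : hmem₀.toLp ψ ≠ 0 := fun h => by
    rw [← norm_toLp_sq hmem₀, h, norm_zero] at hpos
    norm_num at hpos
  have hray := bottomOfSpectrum_le_rayleigh G hGc hG hne (isMagneticGradient_toLp hA hψ hmem₀ hmem₁)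
  rw [norm_toLp_sq hmem₀, PiLp.norm_sq_eq_of_L2] at hray
  rw [integral_finsetSum _ fun j _ => (hmem₁ j).integrable_norm_pow two_ne_zero]
  simp_rw [← norm_toLp_sq (hmem₁ _)]
  exact hray

end MagneticGradient

section Gauge

lemma contDiff_coord {n : WithTop ℕ∞} (j : Fin 3) : ContDiff ℝ n fun x : E3 => x j :=
  (EuclideanSpace.proj (𝕜 := ℝ) j).contDiff

lemma hasFDerivAt_coord (j : Fin 3) (x : E3) :
    HasFDerivAt (fun y : E3 => y j) (EuclideanSpace.proj (𝕜 := ℝ) j) x :=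
  (EuclideanSpace.proj (𝕜 := ℝ) j).hasFDerivAt

/-- The potential `(-b₃ x₂, 0, b₁ x₂ - b₂ x₁ - k)` of the constant field `(b₁, b₂, b₃)`. It does not
depend on `x₃`, and on `x₂ = 0` only its last component survives. -/
def refPotential (B : E3) (k : ℝ) (x : E3) : E3 :=
  !₂[-(B 2) * x 1, 0, B 0 * x 1 - B 1 * x 0 - k]

lemma clm_apply_eq_sum {G : Type*} [NormedAddCommGroup G] [NormedSpace ℝ G] (L : E3 →L[ℝ] G)
    (x : E3) : L x = ∑ i, x i • L (EuclideanSpace.single i 1) := by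
  conv_lhs => rw [← (EuclideanSpace.basisFun (Fin 3) ℝ).sum_repr x, map_sum]
  simp only [map_smul, EuclideanSpace.basisFun_apply, EuclideanSpace.basisFun_repr]

lemma exists_gauge {A : E3 →L[ℝ] E3} {B : E3} (hA : ∀ x, curl A x = B) (k : ℝ) :
    ∃ θ : E3 → ℝ, ContDiff ℝ 1 θ ∧
      ∀ x j, partialDeriv j θ x = A x j - refPotential B k x j := by
  set a : Fin 3 → Fin 3 → ℝ := fun i j => A (EuclideanSpace.single i 1) j with ha
  have hcurl : ∀ j, curl A 0 j = B j := fun j => by rw [hA 0]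
  have hB₀ : a 1 2 - a 2 1 = B 0 := by simp [← hcurl, curl, partialDeriv, ha]
  have hB₁ : a 2 0 - a 0 2 = B 1 := by simp [← hcurl, curl, partialDeriv, ha]
  have hB₂ : a 0 1 - a 1 0 = B 2 := by simp [← hcurl, curl, partialDeriv, ha]
  let θ : E3 → ℝ := fun x => a 0 0 / 2 * (x 0 * x 0) + a 1 1 / 2 * (x 1 * x 1)
    + a 2 2 / 2 * (x 2 * x 2) + a 0 1 * (x 0 * x 1) + a 2 0 * (x 0 * x 2) + a 2 1 * (x 1 * x 2)
    + k * x 2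
  refine ⟨θ, ?_, fun x j => ?_⟩
  · have hquad := fun (c : ℝ) i j => (contDiff_const (c := c)).mul
      ((contDiff_coord (n := 1) i).mul (contDiff_coord j))
    exact ((((((hquad _ 0 0).add (hquad _ 1 1)).add (hquad _ 2 2)).add (hquad _ 0 1)).add
      (hquad _ 0 2)).add (hquad _ 1 2)).add (contDiff_const.mul (contDiff_coord 2))
  · have hquad := fun (c : ℝ) i j =>
      ((hasFDerivAt_coord i x).mul (hasFDerivAt_coord j x)).const_mul c
    have hderiv : HasFDerivAt θ _ x := ((((((hquad (a 0 0 / 2) 0 0).add (hquad (a 1 1 / 2) 1 1)).add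
      (hquad (a 2 2 / 2) 2 2)).add (hquad (a 0 1) 0 1)).add (hquad (a 2 0) 0 2)).add
      (hquad (a 2 1) 1 2)).add ((hasFDerivAt_coord 2 x).const_mul k)
    have hAx : A x j = x 0 * a 0 j + x 1 * a 1 j + x 2 * a 2 j := by
      rw [clm_apply_eq_sum A, Fin.sum_univ_three]
      rfl
    rw [partialDeriv, hderiv.fderiv, hAx]
    fin_cases j <;> simp [refPotential]
    · linear_combination (x 1) * hB₂
    · ring
    · linear_combination (-x 1) * hB₀ + (x 0) * hB₁

lemma partialDeriv_exp_mul {θ g : E3 → ℝ} {x : E3} (hθ : DifferentiableAt ℝ θ x)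
    (hg : DifferentiableAt ℝ g x) (j : Fin 3) :
    partialDeriv j (fun x => Complex.exp (θ x * Complex.I) * (g x : ℂ)) x
      = Complex.exp (θ x * Complex.I) *
        (Complex.I * (partialDeriv j θ x : ℝ) * g x + (partialDeriv j g x : ℝ)) := by
  have hθC : HasFDerivAt (fun x => (θ x : ℂ)) (Complex.ofRealCLM.comp (fderiv ℝ θ x)) x :=
    Complex.ofRealCLM.hasFDerivAt.comp x hθ.hasFDerivAt
  have hgC : HasFDerivAt (fun x => (g x : ℂ)) (Complex.ofRealCLM.comp (fderiv ℝ g x)) x :=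
    Complex.ofRealCLM.hasFDerivAt.comp x hg.hasFDerivAt
  have hderiv : HasFDerivAt (fun x => Complex.exp (θ x * Complex.I) * (g x : ℂ)) _ x :=
    (hθC.mul_const Complex.I).cexp.mul hgC
  rw [partialDeriv, hderiv.fderiv]
  simp only [partialDeriv, add_apply, smul_apply, ContinuousLinearMap.comp_apply,
    Complex.ofRealCLM_apply, smul_eq_mul]
  ring

lemma norm_magneticGradient_exp_mul_sq {θ g : E3 → ℝ} {x : E3} (hθ : DifferentiableAt ℝ θ x)
    (hg : DifferentiableAt ℝ g x) (a : ℝ) (j : Fin 3) :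
    ‖-Complex.I * partialDeriv j (fun x => Complex.exp (θ x * Complex.I) * (g x : ℂ)) x
        - a * (Complex.exp (θ x * Complex.I) * (g x : ℂ))‖ ^ 2
      = partialDeriv j g x ^ 2 + (a - partialDeriv j θ x) ^ 2 * g x ^ 2 := by
  have hfactor : -Complex.I * partialDeriv j (fun x => Complex.exp (θ x * Complex.I) * (g x : ℂ)) x
        - a * (Complex.exp (θ x * Complex.I) * (g x : ℂ))
      = Complex.exp (θ x * Complex.I) * (((partialDeriv j θ x - a) * g x : ℝ)
        + (-partialDeriv j g x : ℝ) * Complex.I) := by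
    rw [partialDeriv_exp_mul hθ hg]
    push_cast
    linear_combination
      (-Complex.exp (θ x * Complex.I) * (partialDeriv j θ x : ℝ) * g x) * Complex.I_sq
  rw [hfactor, norm_mul, Complex.norm_exp_ofReal_mul_I, one_mul, ← Complex.normSq_eq_norm_sq,
    Complex.normSq_add_mul_I]
  ring

lemma groundEnergy_le_of_real_trial {A : E3 →L[ℝ] E3} {B : E3} (hA : ∀ x, curl A x = B) (k : ℝ)
    {α : ℝ} {g : E3 → ℝ} (hg : ContDiff ℝ 1 g) {K : Set E3} (hK : IsCompact K)
    (h0 : ∀ x ∈ wedge α \ K, g x = 0) (hpos : 0 < ∫ x in wedge α, g x ^ 2) :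
    groundEnergy A α ≤ (((∫ x in wedge α, ∑ j, (partialDeriv j g x ^ 2
      + refPotential B k x j ^ 2 * g x ^ 2)) / ∫ x in wedge α, g x ^ 2 : ℝ) : EReal) := by
  obtain ⟨θ, hθ, hdθ⟩ := exists_gauge hA k
  have hψ : ContDiff ℝ 1 fun x => Complex.exp (θ x * Complex.I) * (g x : ℂ) :=
    ((Complex.ofRealCLM.contDiff.comp hθ).mul contDiff_const).cexp.mul
      (Complex.ofRealCLM.contDiff.comp hg)
  have hnorm : ∀ x, ‖Complex.exp (θ x * Complex.I) * (g x : ℂ)‖ ^ 2 = g x ^ 2 := fun x => by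
    rw [norm_mul, Complex.norm_exp_ofReal_mul_I, one_mul, Complex.norm_real, Real.norm_eq_abs,
      sq_abs]
  have hgrad : ∀ j x, _ := fun j x => norm_magneticGradient_exp_mul_sq
    (hθ.differentiable one_ne_zero x) (hg.differentiable one_ne_zero x) (A x j) j
  simp only [hdθ, sub_sub_cancel] at hgrad
  have htrial := groundEnergy_le_of_trial A.continuous hψ hK (α := α)
    (fun x hx => by rw [h0 x hx, Complex.ofReal_zero, mul_zero]) (by simpa only [hnorm] using hpos)
  simpa only [hnorm, hgrad] using htrial

end Gauge

section RadialTrial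

variable {E : Type*} [NormedAddCommGroup E]

/-- The squared norm of `f` in `L²((0, ∞), r dr)`. -/
def radialMass (f : ℝ → E) : ℝ :=
  ∫ r in Ioi (0 : ℝ), ‖f r‖ ^ 2 * r

/-- The second moment of `f` in `L²((0, ∞), r dr)`. -/
def radialMoment (f : ℝ → E) : ℝ :=
  ∫ r in Ioi (0 : ℝ), ‖f r‖ ^ 2 * r ^ 3

variable [NormedSpace ℝ E]

/-- The `C¹` functions on the line that vanish near `+∞`. Their restrictions to the half-line form a
core of the radial operators. -/
structure IsRadialTrial (f : ℝ → E) : Prop where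
  contDiff : ContDiff ℝ 1 f
  eventually_eq_zero : ∀ᶠ r in Filter.atTop, f r = 0

/-- The quadratic form of the radial operator with parameter `τ`. -/
def radialEnergy (τ : ℝ) (f : ℝ → E) : ℝ :=
  ∫ r in Ioi (0 : ℝ), (‖deriv f r‖ ^ 2 + (r - τ) ^ 2 * ‖f r‖ ^ 2) * r

lemma deriv_eq_zero_of_forall_ge {f : ℝ → E} {M r : ℝ} (hM : ∀ s, M ≤ s → f s = 0)
    (hr : M < r) : deriv f r = 0 := by
  have hloc : f =ᶠ[nhds r] fun _ => 0 := by
    filter_upwards [Ioi_mem_nhds hr] with s hs using hM s (le_of_lt hs)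
  rw [hloc.deriv_eq, deriv_const]

lemma IsRadialTrial.exists_forall_ge {f : ℝ → E} (hf : IsRadialTrial f) :
    ∃ M, 0 ≤ M ∧ ∀ r, M ≤ r → f r = 0 ∧ deriv f r = 0 := by
  obtain ⟨M, hM⟩ := Filter.eventually_atTop.1 hf.eventually_eq_zero
  refine ⟨|M| + 1, by positivity, fun r hr => ?_⟩
  have hMr : M < r := (le_abs_self M).trans_lt (by linarith)
  exact ⟨hM r hMr.le, deriv_eq_zero_of_forall_ge hM hMr⟩

lemma IsRadialTrial.comp_mul_left {f : ℝ → E} (hf : IsRadialTrial f) {β : ℝ} (hβ : 0 < β) :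
    IsRadialTrial fun x => f (β * x) where
  contDiff := hf.contDiff.comp (contDiff_const.mul contDiff_id)
  eventually_eq_zero :=
    (Filter.tendsto_id.const_mul_atTop hβ).eventually hf.eventually_eq_zero

lemma IsRadialTrial.continuous_deriv {f : ℝ → E} (hf : IsRadialTrial f) : Continuous (deriv f) :=
  hf.contDiff.continuous_deriv_one

end RadialTrial

section WedgeIntegral

/-- The coordinates of `ℝ³`, grouped as `(x₃, (x₁, x₂))`. -/
def coordEquiv : E3 ≃ᵐ ℝ × (ℝ × ℝ) :=
  (MeasurableEquiv.toLp 2 (Fin 3 → ℝ)).symm.trans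
    ((MeasurableEquiv.piFinSuccAbove (fun _ : Fin 3 => ℝ) 2).trans
      (MeasurableEquiv.prodCongr (MeasurableEquiv.refl ℝ) MeasurableEquiv.finTwoArrow))

lemma coordEquiv_apply (x : E3) : coordEquiv x = (x 2, (x 0, x 1)) := rfl

lemma volume_preserving_coordEquiv : MeasurePreserving coordEquiv volume volume :=
  (((MeasurePreserving.id volume).prod (volume_preserving_finTwoArrow ℝ)).comp
    (volume_preserving_piFinSuccAbove (fun _ : Fin 3 => ℝ) 2)).comp
    (EuclideanSpace.volume_preserving_symm_measurableEquiv_toLp (Fin 3))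

/-- The planar sector `|y| < t x`, the cross-section of a wedge with `t = tan (α / 2)`. -/
def sector (t : ℝ) : Set (ℝ × ℝ) := {z | |z.2| < z.1 * t}

lemma measurableSet_sector (t : ℝ) : MeasurableSet (sector t) :=
  (isOpen_lt (continuous_snd.abs) (continuous_fst.mul continuous_const)).measurableSet

lemma fst_pos_of_abs_snd_lt {t x y : ℝ} (ht : 0 < t) (h : |y| < x * t) : 0 < x :=
  pos_of_mul_pos_left ((abs_nonneg _).trans_lt h) ht.le

lemma setIntegral_wedge_mul (α : ℝ) (P : ℝ × ℝ → ℝ) (s : ℝ → ℝ) :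
    ∫ x in wedge α, P (x 0, x 1) * s (x 2)
      = (∫ z in sector (Real.tan (α / 2)), P z) * ∫ y, s y := by
  have hpre : wedge α = coordEquiv ⁻¹' (univ ×ˢ sector (Real.tan (α / 2))) := by
    ext x
    simp [wedge, sector, coordEquiv_apply]
  calc ∫ x in wedge α, P (x 0, x 1) * s (x 2)
      = ∫ x in coordEquiv ⁻¹' (univ ×ˢ sector (Real.tan (α / 2))),
          s (coordEquiv x).1 * P (coordEquiv x).2 := by
        simp only [hpre, coordEquiv_apply, mul_comm]
    _ = ∫ z in univ ×ˢ sector (Real.tan (α / 2)), s z.1 * P z.2 :=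
        volume_preserving_coordEquiv.setIntegral_preimage_emb coordEquiv.measurableEmbedding
          (fun z => s z.1 * P z.2) _
    _ = (∫ y, s y) * ∫ z in sector (Real.tan (α / 2)), P z := by
        rw [Measure.volume_eq_prod, setIntegral_prod_mul, Measure.restrict_univ]
    _ = _ := mul_comm _ _

lemma integrableOn_sector {t : ℝ} (ht : 0 < t) {p q : ℝ → ℝ} (hp : Continuous p)
    (hq : Continuous q) {M : ℝ} (hM : ∀ x, M ≤ x → p x = 0) :
    IntegrableOn (fun z => p z.1 * q z.2) (sector t) := by
  refine memLp_one_iff_integrable.1 (memLp_of_continuous_of_ae_eq_zero_off_compact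
    ((hp.comp continuous_fst).mul (hq.comp continuous_snd))
    (isCompact_Icc (a := 0) (b := M) |>.prod (isCompact_Icc (a := -(M * t)) (b := M * t))) ?_ 1)
  filter_upwards [ae_restrict_mem (measurableSet_sector t)] with z (hz : |z.2| < z.1 * t) hzK
  have hMz : M ≤ z.1 := by
    by_contra! hzM
    exact hzK ⟨⟨(fst_pos_of_abs_snd_lt ht hz).le, hzM.le⟩,
      abs_le.1 (hz.le.trans (mul_le_mul_of_nonneg_right hzM.le ht.le))⟩
  exact mul_eq_zero_of_left (hM _ hMz) _

lemma setIntegral_sector {t : ℝ} (ht : 0 < t) {p q : ℝ → ℝ} (hp : Continuous p)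
    (hq : Continuous q) {M : ℝ} (hM : ∀ x, M ≤ x → p x = 0) :
    ∫ z in sector t, p z.1 * q z.2
      = ∫ x in Ioi (0 : ℝ), p x * ∫ y in (-(x * t))..(x * t), q y := by
  have hsection : ∀ x, (fun y => (sector t).indicator (fun z => p z.1 * q z.2) (x, y))
      = (Ioo (-(x * t)) (x * t)).indicator fun y => p x * q y := fun x => by
    ext y
    simp only [indicator, sector, mem_ofPred_eq, mem_Ioo, abs_lt]
  have hinner : ∀ x, ∫ y, (sector t).indicator (fun z => p z.1 * q z.2) (x, y)
      = p x * ∫ y in Ioo (-(x * t)) (x * t), q y := fun x => by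
    rw [hsection, integral_indicator measurableSet_Ioo, integral_const_mul]
  rw [← integral_indicator (measurableSet_sector t), Measure.volume_eq_prod, integral_prod _
    ((integrable_indicator_iff (measurableSet_sector t)).2 (integrableOn_sector ht hp hq hM))]
  simp only [hinner]
  rw [← setIntegral_eq_integral_of_forall_compl_eq_zero (s := Ioi (0 : ℝ))]
  · refine setIntegral_congr_fun measurableSet_Ioi fun x (hx : 0 < x) => ?_
    rw [intervalIntegral.integral_of_le (by nlinarith), integral_Ioc_eq_integral_Ioo]
  · intro x hx
    rw [Ioo_eq_empty (by rw [mem_Ioi, not_lt] at hx; nlinarith), setIntegral_empty, mul_zero]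

lemma setIntegral_wedge_mul_pow_mul {α : ℝ} (ht : 0 < Real.tan (α / 2)) {p : ℝ → ℝ}
    (hp : Continuous p) {M : ℝ} (hM : ∀ x, M ≤ x → p x = 0) (n : ℕ) (s : ℝ → ℝ) :
    ∫ x in wedge α, p (x 0) * x 1 ^ n * s (x 2)
      = (1 - (-1) ^ (n + 1)) / (n + 1) * Real.tan (α / 2) ^ (n + 1)
        * (∫ x in Ioi (0 : ℝ), p x * x ^ (n + 1)) * ∫ y, s y := by
  have hinner : ∫ x in Ioi (0 : ℝ), p x * ∫ y in (-(x * Real.tan (α / 2)))..(x * Real.tan (α / 2)),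
        y ^ n
      = (1 - (-1) ^ (n + 1)) / (n + 1) * Real.tan (α / 2) ^ (n + 1)
        * ∫ x in Ioi (0 : ℝ), p x * x ^ (n + 1) := by
    rw [← integral_const_mul]
    refine integral_congr_ae (.of_forall fun x => ?_)
    simp only [integral_pow, neg_eq_neg_one_mul (x * _), mul_pow]
    ring
  rw [setIntegral_wedge_mul α (fun z => p z.1 * z.2 ^ n) s,
    setIntegral_sector ht hp (continuous_pow n) hM, hinner]

lemma exists_compact_wedge {α : ℝ} (ht : 0 < Real.tan (α / 2)) (M R : ℝ) :
    ∃ K : Set E3, IsCompact K ∧ ∀ x ∈ wedge α \ K, M ≤ x 0 ∨ R ≤ |x 2| := by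
  let b : Fin 3 → ℝ := ![M, M * Real.tan (α / 2), R]
  refine ⟨WithLp.toLp 2 '' Icc (-b) b, isCompact_Icc.image (PiLp.continuous_toLp 2 _), ?_⟩
  rintro x ⟨(hx : |x 1| < x 0 * Real.tan (α / 2)), hxK⟩
  by_contra! hcon
  have hx0 : |x 0| ≤ M := (abs_of_pos (fst_pos_of_abs_snd_lt ht hx)).trans_le hcon.1.le
  have hx1 : |x 1| ≤ M * Real.tan (α / 2) :=
    hx.le.trans (mul_le_mul_of_nonneg_right hcon.1.le ht.le)
  have hxb : ∀ i, |x i| ≤ b i := by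
    rw [Fin.forall_fin_succ, Fin.forall_fin_two]
    exact ⟨hx0, hx1, hcon.2.le⟩
  exact hxK ⟨x.ofLp, ⟨fun i => (abs_le.1 (hxb i)).1, fun i => (abs_le.1 (hxb i)).2⟩, rfl⟩

lemma integrableOn_wedge {α : ℝ} (ht : 0 < Real.tan (α / 2)) {p q s : ℝ → ℝ} (hp : Continuous p)
    (hq : Continuous q) (hs : Continuous s) {M : ℝ} (hM : ∀ x, M ≤ x → p x = 0)
    (hsc : HasCompactSupport s) :
    IntegrableOn (fun x : E3 => p (x 0) * q (x 1) * s (x 2)) (wedge α) := by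
  obtain ⟨R, -, hR⟩ := hsc.exists_pos_le_norm
  obtain ⟨K, hK, hKc⟩ := exists_compact_wedge ht M R
  have hcont : Continuous fun x : E3 => p (x 0) * q (x 1) * s (x 2) :=
    ((hp.comp (continuous_coord 0)).mul (hq.comp (continuous_coord 1))).mul
      (hs.comp (continuous_coord 2))
  refine memLp_one_iff_integrable.1
    (memLp_of_continuous_of_ae_eq_zero_off_compact hcont hK ?_ 1)
  filter_upwards [ae_restrict_mem (isOpen_wedge α).measurableSet] with x hx hxK
  rcases hKc x ⟨hx, hxK⟩ with h | h
  · rw [hM _ h, zero_mul, zero_mul]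
  · rw [hR _ h, mul_zero]

end WedgeIntegral

section ProductTrial

lemma partialDeriv_mul_coord {F χ : ℝ → ℝ} (hF : Differentiable ℝ F) (hχ : Differentiable ℝ χ)
    (x : E3) (j : Fin 3) :
    partialDeriv j (fun x : E3 => F (x 0) * χ (x 2)) x
      = (if j = 0 then deriv F (x 0) * χ (x 2) else 0)
        + (if j = 2 then F (x 0) * deriv χ (x 2) else 0) := by
  have hFx : HasFDerivAt (fun x : E3 => F (x 0)) _ x :=
    (hF (x 0)).hasDerivAt.comp_hasFDerivAt x (hasFDerivAt_coord 0 x)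
  have hχx : HasFDerivAt (fun x : E3 => χ (x 2)) _ x :=
    (hχ (x 2)).hasDerivAt.comp_hasFDerivAt x (hasFDerivAt_coord 2 x)
  have hderiv : HasFDerivAt (fun x : E3 => F (x 0) * χ (x 2)) _ x := hFx.mul hχx
  rw [partialDeriv, hderiv.fderiv]
  change F (x 0) * (deriv χ (x 2) * EuclideanSpace.single j (1 : ℝ) 2)
    + χ (x 2) * (deriv F (x 0) * EuclideanSpace.single j (1 : ℝ) 0) = _
  simp only [PiLp.single_apply, eq_comm (b := j), mul_ite, mul_one, mul_zero]
  rw [add_comm, mul_comm (χ _)]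

variable {α : ℝ} {F χ : ℝ → ℝ}

lemma setIntegral_wedge_mul_sq (ht : 0 < Real.tan (α / 2)) (hF : IsRadialTrial F) :
    ∫ x in wedge α, (F (x 0) * χ (x 2)) ^ 2
      = 2 * Real.tan (α / 2) * radialMass F * ∫ y, χ y ^ 2 := by
  obtain ⟨M, -, hM⟩ := hF.exists_forall_ge
  have hint := setIntegral_wedge_mul_pow_mul ht (hF.contDiff.continuous.pow 2) (M := M)
    (fun x hx => by rw [Pi.pow_apply, (hM x hx).1, zero_pow two_ne_zero]) 0 (fun y => χ y ^ 2)
  simp only [Pi.pow_apply, zero_add, pow_one, pow_zero, mul_one] at hint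
  simp only [mul_pow, hint, radialMass, Real.norm_eq_abs, sq_abs]
  norm_num

lemma sum_partialDeriv_mul_coord_sq (B : E3) (k : ℝ) (hF : Differentiable ℝ F)
    (hχ : Differentiable ℝ χ) (x : E3) :
    ∑ j, (partialDeriv j (fun x : E3 => F (x 0) * χ (x 2)) x ^ 2
        + refPotential B k x j ^ 2 * (F (x 0) * χ (x 2)) ^ 2)
      = (deriv F (x 0) ^ 2 + (B 1 * x 0 + k) ^ 2 * F (x 0) ^ 2) * x 1 ^ 0 * χ (x 2) ^ 2
        + -2 * B 0 * ((B 1 * x 0 + k) * F (x 0) ^ 2 * x 1 ^ 1 * χ (x 2) ^ 2)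
        + (B 0 ^ 2 + B 2 ^ 2) * (F (x 0) ^ 2 * x 1 ^ 2 * χ (x 2) ^ 2)
        + F (x 0) ^ 2 * x 1 ^ 0 * deriv χ (x 2) ^ 2 := by
  simp only [partialDeriv_mul_coord hF hχ, Fin.sum_univ_three, refPotential]
  simp only [↓reduceIte, Fin.isValue, Fin.reduceEq, add_zero, Matrix.cons_val_zero, zero_pow,
    Matrix.cons_val_one, ne_eq, OfNat.ofNat_ne_zero, not_false_eq_true, zero_mul, zero_add,
    Matrix.cons_val]
  ring

/-- The cross term `-2 b₁ x₂ (b₂ x₁ + k)` of the potential integrates to zero because the wedge is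
symmetric in `x₂`. -/
lemma setIntegral_wedge_energy (ht : 0 < Real.tan (α / 2)) (B : E3) (k : ℝ)
    (hF : IsRadialTrial F) (hχ : ContDiff ℝ 1 χ) (hχc : HasCompactSupport χ) :
    ∫ x in wedge α, ∑ j, (partialDeriv j (fun x : E3 => F (x 0) * χ (x 2)) x ^ 2
        + refPotential B k x j ^ 2 * (F (x 0) * χ (x 2)) ^ 2)
      = 2 * Real.tan (α / 2) * ((∫ x in Ioi (0 : ℝ),
          (deriv F x ^ 2 + (B 1 * x + k) ^ 2 * F x ^ 2) * x) * ∫ y, χ y ^ 2)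
        + 2 / 3 * Real.tan (α / 2) ^ 3 * ((B 0 ^ 2 + B 2 ^ 2) * radialMoment F * ∫ y, χ y ^ 2)
        + 2 * Real.tan (α / 2) * (radialMass F * ∫ y, deriv χ y ^ 2) := by
  obtain ⟨M, -, hM⟩ := hF.exists_forall_ge
  have hχsq : HasCompactSupport fun y => χ y ^ 2 :=
    hχc.comp_left (g := fun y => y ^ 2) (zero_pow two_ne_zero)
  have hdχsq : HasCompactSupport fun y => deriv χ y ^ 2 :=
    hχc.deriv.comp_left (g := fun y => y ^ 2) (zero_pow two_ne_zero)
  have hlin : Continuous fun x => B 1 * x + k := by fun_prop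
  have hFsq : Continuous fun x => F x ^ 2 := hF.contDiff.continuous.pow 2
  have hcross : Continuous fun x => (B 1 * x + k) * F x ^ 2 := hlin.mul hFsq
  have henergy : Continuous fun x => deriv F x ^ 2 + (B 1 * x + k) ^ 2 * F x ^ 2 :=
    (hF.continuous_deriv.pow 2).add ((hlin.pow 2).mul hFsq)
  have hMsq : ∀ x, M ≤ x → F x ^ 2 = 0 := fun x hx => by rw [(hM x hx).1, zero_pow two_ne_zero]
  have hMcross : ∀ x, M ≤ x → (B 1 * x + k) * F x ^ 2 = 0 := fun x hx => by
    rw [hMsq x hx, mul_zero]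
  have hMenergy : ∀ x, M ≤ x → deriv F x ^ 2 + (B 1 * x + k) ^ 2 * F x ^ 2 = 0 := fun x hx => by
    rw [hMsq x hx, (hM x hx).2, mul_zero, zero_pow two_ne_zero, add_zero]
  have hχcont : Continuous fun y => χ y ^ 2 := hχ.continuous.pow 2
  have hdχcont : Continuous fun y => deriv χ y ^ 2 := hχ.continuous_deriv_one.pow 2
  have hint₁ := integrableOn_wedge ht henergy (continuous_pow 0) hχcont hMenergy hχsq
  have hint₂ := (integrableOn_wedge ht hcross (continuous_pow 1) hχcont hMcross hχsq).const_mul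
    (-2 * B 0)
  have hint₃ := (integrableOn_wedge ht hFsq (continuous_pow 2) hχcont hMsq hχsq).const_mul
    (B 0 ^ 2 + B 2 ^ 2)
  have hint₄ := integrableOn_wedge ht hFsq (continuous_pow 0) hdχcont hMsq hdχsq
  simp only [sum_partialDeriv_mul_coord_sq B k (hF.contDiff.differentiable one_ne_zero)
    (hχ.differentiable one_ne_zero)]
  rw [integral_add (by exact (hint₁.add hint₂).add hint₃) hint₄,
    integral_add (by exact hint₁.add hint₂) hint₃, integral_add hint₁ hint₂, integral_const_mul,
    integral_const_mul,
    setIntegral_wedge_mul_pow_mul ht henergy hMenergy 0 (fun y => χ y ^ 2),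
    setIntegral_wedge_mul_pow_mul ht hcross hMcross 1 (fun y => χ y ^ 2),
    setIntegral_wedge_mul_pow_mul ht hFsq hMsq 2 (fun y => χ y ^ 2),
    setIntegral_wedge_mul_pow_mul ht hFsq hMsq 0 (fun y => deriv χ y ^ 2)]
  simp only [radialMass, radialMoment, Real.norm_eq_abs, sq_abs, zero_add, pow_one]
  norm_num
  ring

lemma groundEnergy_le_of_product_trial {A : E3 →L[ℝ] E3} {B : E3} (hA : ∀ x, curl A x = B)
    (k : ℝ) (ht : 0 < Real.tan (α / 2)) (hF : IsRadialTrial F) (hmass : 0 < radialMass F)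
    (hχ : ContDiff ℝ 1 χ) (hχc : HasCompactSupport χ) (hχpos : 0 < ∫ y, χ y ^ 2) :
    groundEnergy A α ≤ (((∫ x in Ioi (0 : ℝ), (deriv F x ^ 2 + (B 1 * x + k) ^ 2 * F x ^ 2) * x)
        / radialMass F
      + (B 0 ^ 2 + B 2 ^ 2) * Real.tan (α / 2) ^ 2 / 3 * (radialMoment F / radialMass F)
      + (∫ y, deriv χ y ^ 2) / ∫ y, χ y ^ 2 : ℝ) : EReal) := by
  obtain ⟨M, -, hM⟩ := hF.exists_forall_ge
  obtain ⟨R, -, hR⟩ := hχc.exists_pos_le_norm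
  obtain ⟨K, hK, hKc⟩ := exists_compact_wedge ht M R
  have hg : ContDiff ℝ 1 fun x : E3 => F (x 0) * χ (x 2) :=
    (hF.contDiff.comp (contDiff_coord 0)).mul (hχ.comp (contDiff_coord 2))
  have hg0 : ∀ x ∈ wedge α \ K, F (x 0) * χ (x 2) = 0 := fun x hx =>
    (hKc x hx).elim (fun h => mul_eq_zero_of_left (hM _ h).1 _)
      fun h => mul_eq_zero_of_right _ (hR _ h)
  have hnorm := setIntegral_wedge_mul_sq (χ := χ) ht hF
  refine (groundEnergy_le_of_real_trial hA k hg hK hg0 (by rw [hnorm]; positivity)).trans_eq ?_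
  rw [EReal.coe_eq_coe_iff, hnorm, setIntegral_wedge_energy ht B k hF hχ hχc]
  field_simp

lemma exists_small_energy_cutoff {ε : ℝ} (hε : 0 < ε) :
    ∃ χ : ℝ → ℝ, ContDiff ℝ 1 χ ∧ HasCompactSupport χ ∧ 0 < ∫ y, χ y ^ 2 ∧
      (∫ y, deriv χ y ^ 2) / ∫ y, χ y ^ 2 < ε := by
  let b : ContDiffBump (0 : ℝ) := ⟨1, 2, one_pos, one_lt_two⟩
  set D := ∫ y, deriv b y ^ 2
  set N := ∫ y, b y ^ 2
  have hN : 0 < N := by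
    refine Continuous.integral_pos_of_hasCompactSupport_nonneg_nonzero (x := 0)
      (b.continuous.pow 2)
      (b.hasCompactSupport.comp_left (g := fun y => y ^ 2) (zero_pow two_ne_zero))
      (fun y => sq_nonneg _) ?_
    rw [b.one_of_mem_closedBall (Metric.mem_closedBall_self b.rIn_pos.le)]
    norm_num
  have hlim : Filter.Tendsto (fun c : ℝ => c ^ 2 * (D / N)) (nhdsWithin 0 (Ioi 0)) (nhds 0) := by
    have hcont : Continuous fun c : ℝ => c ^ 2 * (D / N) := by fun_prop
    simpa using (hcont.tendsto 0).mono_left nhdsWithin_le_nhds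
  obtain ⟨c, hcε, hc : 0 < c⟩ := ((hlim.eventually_lt_const hε).and self_mem_nhdsWithin).exists
  have hderiv : ∀ y, deriv (fun y => b (c * y)) y = c * deriv b (c * y) := fun y =>
    deriv_comp_mul_left c b y
  have hmass : ∫ y, b (c * y) ^ 2 = c⁻¹ * N := by
    rw [Measure.integral_comp_mul_left (fun y => b y ^ 2) c, abs_of_pos (inv_pos.2 hc), smul_eq_mul]
  have henergy : ∫ y, deriv (fun y => b (c * y)) y ^ 2 = c ^ 2 * (c⁻¹ * D) := by
    simp only [hderiv, mul_pow]
    rw [integral_const_mul, Measure.integral_comp_mul_left (fun y => deriv b y ^ 2) c,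
      abs_of_pos (inv_pos.2 hc), smul_eq_mul]
  refine ⟨fun y => b (c * y), b.contDiff.comp (contDiff_const.mul contDiff_id),
    b.hasCompactSupport.comp_homeomorph (Homeomorph.mulLeft₀ c hc.ne'), ?_, ?_⟩
  · rw [hmass]
    positivity
  · rw [hmass, henergy]
    rwa [mul_left_comm, mul_div_mul_left _ _ (inv_ne_zero hc.ne'), mul_div_assoc]

end ProductTrial

section Scaling

lemma integral_comp_mul_pow {β : ℝ} (hβ : 0 < β) (h : ℝ → ℝ) (n : ℕ) :
    ∫ x in Ioi (0 : ℝ), h (β * x) * x ^ n = (β ^ (n + 1))⁻¹ * ∫ r in Ioi (0 : ℝ), h r * r ^ n := by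
  have hsub := integral_comp_mul_left_Ioi (fun r => h r * (β⁻¹ * r) ^ n) 0 hβ
  simp only [inv_mul_cancel_left₀ hβ.ne', mul_zero, smul_eq_mul, mul_pow, mul_left_comm (h _)]
    at hsub
  rw [hsub, integral_const_mul, ← mul_assoc, pow_succ', mul_inv, inv_pow]

variable {f : ℝ → ℝ} {β : ℝ}

lemma radialMass_comp_mul_left (hβ : 0 < β) :
    radialMass (fun x => f (β * x)) = (β ^ 2)⁻¹ * radialMass f := by
  simpa only [radialMass, pow_one, one_add_one_eq_two]
    using integral_comp_mul_pow hβ (fun r => ‖f r‖ ^ 2) 1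

lemma radialMoment_comp_mul_left (hβ : 0 < β) :
    radialMoment (fun x => f (β * x)) = (β ^ 4)⁻¹ * radialMoment f :=
  integral_comp_mul_pow hβ (fun r => ‖f r‖ ^ 2) 3

lemma integral_comp_mul_left_eq_radialEnergy (hβ : 0 < β) (τ : ℝ) :
    ∫ x in Ioi (0 : ℝ), (deriv (fun x => f (β * x)) x ^ 2
      + (β ^ 2 * x + -(β * τ)) ^ 2 * f (β * x) ^ 2) * x = radialEnergy τ f := by
  have hsub := integral_comp_mul_pow hβ
    (fun r => ‖deriv f r‖ ^ 2 + (r - τ) ^ 2 * ‖f r‖ ^ 2) 1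
  simp only [pow_one, one_add_one_eq_two, Real.norm_eq_abs, sq_abs] at hsub
  rw [← inv_mul_eq_iff_eq_mul₀ (by positivity), inv_inv, ← integral_const_mul] at hsub
  simp only [radialEnergy, Real.norm_eq_abs, sq_abs]
  rw [← hsub]
  refine integral_congr_ae (.of_forall fun x => ?_)
  simp only [deriv_comp_mul_left, smul_eq_mul]
  ring

/-- The trial function is `f (√b₂ x₁) χ (x₃)`, in the gauge `k = -√b₂ τ`; spreading `χ` out makes
its contribution negligible. -/
theorem groundEnergy_le_of_radial_trial {A : E3 →L[ℝ] E3} {B : E3} (hA : ∀ x, curl A x = B)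
    (hB : 0 < B 1) {α : ℝ} (ht : 0 < Real.tan (α / 2)) (τ : ℝ) (hf : IsRadialTrial f)
    (hmass : 0 < radialMass f) :
    groundEnergy A α ≤ ((B 1 * (radialEnergy τ f / radialMass f)
      + (B 0 ^ 2 + B 2 ^ 2) * Real.tan (α / 2) ^ 2 / (3 * B 1)
        * (radialMoment f / radialMass f) : ℝ) : EReal) := by
  refine EReal.le_of_forall_lt_iff_le.1 fun z hz => ?_
  obtain ⟨χ, hχ, hχc, hχpos, hχε⟩ :=
    exists_small_energy_cutoff (sub_pos.2 (EReal.coe_lt_coe_iff.1 hz))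
  set β := √(B 1)
  have hβ : 0 < β := Real.sqrt_pos.2 hB
  have hβsq : B 1 = β ^ 2 := (Real.sq_sqrt hB.le).symm
  have htrial := groundEnergy_le_of_product_trial hA (-(β * τ)) ht (hf.comp_mul_left hβ)
    (by rw [radialMass_comp_mul_left hβ]; positivity) hχ hχc hχpos
  rw [hβsq, integral_comp_mul_left_eq_radialEnergy hβ, radialMass_comp_mul_left hβ,
    radialMoment_comp_mul_left hβ, ← hβsq] at htrial
  refine htrial.trans ?_
  rw [EReal.coe_le_coe_iff]
  refine le_of_eq_of_le ?_ (lt_sub_iff_add_lt'.1 hχε).le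
  rw [hβsq]
  field_simp

end Scaling

section HalfLine

lemma integrableOn_Ioi_of_continuous {E : Type*} [NormedAddCommGroup E] {F : ℝ → E}
    (hF : Continuous F) {a M : ℝ} (hM : ∀ r, M ≤ r → F r = 0) : IntegrableOn F (Ioi a) := by
  refine memLp_one_iff_integrable.1
    (memLp_of_continuous_of_ae_eq_zero_off_compact hF (isCompact_Icc (a := a) (b := M)) ?_ 1)
  filter_upwards [ae_restrict_mem measurableSet_Ioi] with r (hr : a < r) hrK
  exact hM r (not_lt.1 fun hrM => hrK ⟨hr.le, hrM.le⟩)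

lemma setIntegral_Ioi_eq_intervalIntegral {E : Type*} [NormedAddCommGroup E] [NormedSpace ℝ E]
    {F : ℝ → E} {a M : ℝ} (haM : a ≤ M) (hM : ∀ r, M ≤ r → F r = 0) :
    ∫ r in Ioi a, F r = ∫ r in a..M, F r := by
  rw [intervalIntegral.integral_of_le haM]
  exact setIntegral_eq_of_subset_of_forall_sdiff_eq_zero measurableSet_Ioi Ioc_subset_Ioi_self
    fun r hr => hM r (not_lt.1 fun hrM => hr.2 ⟨hr.1, hrM.le⟩)

end HalfLine

section RadialTrial

variable {E : Type*} [NormedAddCommGroup E]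

lemma radialMass_nonneg (f : ℝ → E) : 0 ≤ radialMass f :=
  setIntegral_nonneg measurableSet_Ioi fun _ hr => mul_nonneg (sq_nonneg _) (le_of_lt hr)

variable [NormedSpace ℝ E] {f : ℝ → E}

lemma IsRadialTrial.integrableOn_norm_sq_mul_pow (hf : IsRadialTrial f) (n : ℕ) :
    IntegrableOn (fun r => ‖f r‖ ^ 2 * r ^ n) (Ioi 0) := by
  obtain ⟨M, -, hM⟩ := hf.exists_forall_ge
  have hcont := hf.contDiff.continuous
  refine integrableOn_Ioi_of_continuous (M := M) (by fun_prop) fun r hr => ?_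
  rw [(hM r hr).1, norm_zero, zero_pow two_ne_zero, zero_mul]

lemma IsRadialTrial.integrableOn_mass (hf : IsRadialTrial f) :
    IntegrableOn (fun r => ‖f r‖ ^ 2 * r) (Ioi 0) := by
  simpa only [pow_one] using hf.integrableOn_norm_sq_mul_pow 1

lemma IsRadialTrial.integrableOn_energy (hf : IsRadialTrial f) (τ : ℝ) :
    IntegrableOn (fun r => (‖deriv f r‖ ^ 2 + (r - τ) ^ 2 * ‖f r‖ ^ 2) * r) (Ioi 0) := by
  obtain ⟨M, -, hM⟩ := hf.exists_forall_ge
  have hcont := hf.contDiff.continuous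
  have hderiv := hf.continuous_deriv
  refine integrableOn_Ioi_of_continuous (M := M) (by fun_prop) fun r hr => ?_
  rw [(hM r hr).1, (hM r hr).2, norm_zero, zero_pow two_ne_zero, mul_zero, add_zero, zero_mul]

end RadialTrial

section LowerBound

lemma deriv_weight_mul_sq_le {W' W V r f f' : ℝ} (hr : 0 < r)
    (h : W' * r + W ^ 2 ≤ V * r ^ 2) :
    W' * f ^ 2 + W * (2 * f * f') ≤ (f' ^ 2 + V * f ^ 2) * r := by
  have hsquare : ((f' ^ 2 + V * f ^ 2) * r - (W' * f ^ 2 + W * (2 * f * f'))) * r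
      = (r * f' - W * f) ^ 2 + (V * r ^ 2 - (W' * r + W ^ 2)) * f ^ 2 := by ring
  have hnonneg : 0 ≤ (r * f' - W * f) ^ 2 + (V * r ^ 2 - (W' * r + W ^ 2)) * f ^ 2 :=
    add_nonneg (sq_nonneg _) (mul_nonneg (sub_nonneg.2 h) (sq_nonneg _))
  exact sub_nonneg.1 (nonneg_of_mul_nonneg_left (hsquare ▸ hnonneg) hr)

lemma sub_le_integral_of_riccati {f V W W' : ℝ → ℝ} (hf : ContDiff ℝ 1 f) {a b : ℝ} (ha : 0 ≤ a)
    (hab : a ≤ b) (hV : Continuous V) (hW : ∀ r, HasDerivAt W (W' r) r) (hW' : Continuous W')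
    (h : ∀ r ∈ Ioo a b, W' r * r + W r ^ 2 ≤ V r * r ^ 2) :
    W b * f b ^ 2 - W a * f a ^ 2 ≤ ∫ r in a..b, (deriv f r ^ 2 + V r * f r ^ 2) * r := by
  have hfc := hf.continuous
  have := hf.continuous_deriv_one
  have hWc : Continuous W := continuous_iff_continuousAt.2 fun r => (hW r).continuousAt
  have hderiv : ∀ r, HasDerivAt (fun r => W r * f r ^ 2)
      (W' r * f r ^ 2 + W r * (2 * f r * deriv f r)) r := fun r => by
    refine ((hW r).mul ((hf.differentiable one_ne_zero r).hasDerivAt.pow 2)).congr_deriv ?_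
    simp only [Nat.cast_ofNat, Nat.add_one_sub_one, pow_one, Pi.pow_apply]
  have hcont : Continuous fun r => W' r * f r ^ 2 + W r * (2 * f r * deriv f r) := by fun_prop
  have hcont' : Continuous fun r => (deriv f r ^ 2 + V r * f r ^ 2) * r := by fun_prop
  rw [← intervalIntegral.integral_eq_sub_of_hasDerivAt (fun r _ => hderiv r)
    (hcont.intervalIntegrable _ _)]
  exact intervalIntegral.integral_mono_on_of_le_Ioo hab (hcont.intervalIntegrable _ _)
    (hcont'.intervalIntegrable _ _) fun r hr => deriv_weight_mul_sq_le (ha.trans_lt hr.1) (h r hr)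

lemma riccati_near_zero {l δ r τ : ℝ} (hl0 : 0 ≤ l) (hl1 : l < 1) (hr0 : 0 ≤ r)
    (hr : (1 - l) * r ≤ 1) (hδ : 5 * (1 - l) + 2 ≤ (1 - l) * δ) (hδτ : δ ≤ τ - r) :
    (1 + l) / 2 * ((1 - l) * δ) * (2 * r) * r + ((1 + l) / 2 * ((1 - l) * δ) * r ^ 2) ^ 2
      ≤ ((r - τ) ^ 2 - l) * r ^ 2 := by
  set μ := (1 + l) / 2 with hμ
  set c := μ * ((1 - l) * δ)
  have : 0 ≤ μ := by positivity
  have hδ5 : 5 ≤ δ := by nlinarith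
  have hc0 : 0 ≤ c * r := by have := sub_nonneg.2 hl1.le; positivity
  have hcr : (c * r) ^ 2 ≤ (μ * δ) ^ 2 := by
    refine pow_le_pow_left₀ hc0 ?_ 2
    calc c * r = μ * δ * ((1 - l) * r) := by ring
      _ ≤ μ * δ := mul_le_of_le_one_right (by positivity) hr
  have hgap : 2 * c + (μ * δ) ^ 2 + l ≤ δ ^ 2 := by
    have hμδ : (μ * δ) ^ 2 ≤ μ * δ ^ 2 := by
      rw [mul_pow]
      exact mul_le_mul_of_nonneg_right (by nlinarith) (sq_nonneg δ)
    have hquad : (5 * (1 - l) + 2) * δ ≤ (1 - l) * δ * δ :=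
      mul_le_mul_of_nonneg_right hδ (by positivity)
    have hc : c ≤ (1 - l) * δ := mul_le_of_le_one_left (by nlinarith) (by linarith)
    nlinarith
  have hδr : δ ^ 2 ≤ (r - τ) ^ 2 := by nlinarith
  calc c * (2 * r) * r + (c * r ^ 2) ^ 2 = (2 * c + (c * r) ^ 2) * r ^ 2 := by ring
    _ ≤ ((r - τ) ^ 2 - l) * r ^ 2 :=
      mul_le_mul_of_nonneg_right (by linarith) (sq_nonneg r)

lemma riccati_near_infty {l r τ : ℝ} (hl0 : 0 ≤ l) (hl1 : l < 1) (hr : 1 ≤ (1 - l) * r) :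
    (1 + l) / 2 * (τ - 2 * r) * r + ((1 + l) / 2 * (τ * r - r ^ 2) - 1 / 2) ^ 2
      ≤ ((r - τ) ^ 2 - l) * r ^ 2 := by
  have hr1 : 1 ≤ r := by nlinarith
  have hμ : ((1 + l) / 2) ^ 2 * ((r - τ) * r) ^ 2 ≤ ((r - τ) * r) ^ 2 :=
    mul_le_of_le_one_left (sq_nonneg _) (by nlinarith)
  have hgap : 1 / 4 + l * r ^ 2 ≤ (1 + l) / 2 * r ^ 2 := by nlinarith [hr1]
  calc (1 + l) / 2 * (τ - 2 * r) * r + ((1 + l) / 2 * (τ * r - r ^ 2) - 1 / 2) ^ 2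
      = ((1 + l) / 2) ^ 2 * ((r - τ) * r) ^ 2 + (1 / 4 - (1 + l) / 2 * r ^ 2) := by ring
    _ ≤ ((r - τ) * r) ^ 2 - l * r ^ 2 := by linarith
    _ = ((r - τ) ^ 2 - l) * r ^ 2 := by ring

lemma radialEnergy_sub_mul_radialMass {f : ℝ → ℝ} (hf : IsRadialTrial f) (τ l : ℝ) :
    radialEnergy τ f - l * radialMass f
      = ∫ r in Ioi (0 : ℝ), (deriv f r ^ 2 + ((r - τ) ^ 2 - l) * f r ^ 2) * r := by
  rw [radialEnergy, radialMass, ← integral_const_mul,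
    ← integral_sub (hf.integrableOn_energy τ) (hf.integrableOn_mass.const_mul l)]
  refine integral_congr_ae (.of_forall fun r => ?_)
  simp only [Real.norm_eq_abs, sq_abs]
  ring

/- For `τ` large, the first level is almost that of the harmonic oscillator on the line, which is
`1`. The two solutions of the Riccati inequality `r W' + W² ≤ ((r - τ)² - l) r²`, the multiple of
`r²` near `0` and `μ r (τ - r) - 1 / 2` near `∞` with `μ = (1 + l) / 2`, are exchanged at
`r₀ = 1 / (1 - l)`, where the first one dominates the second. -/
lemma exists_forall_mul_radialMass_le_radialEnergy {l : ℝ} (hl0 : 0 ≤ l) (hl1 : l < 1) :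
    ∃ T, ∀ τ, T ≤ τ → ∀ f : ℝ → ℝ, IsRadialTrial f → l * radialMass f ≤ radialEnergy τ f := by
  have hη : 0 < 1 - l := sub_pos.2 hl1
  obtain ⟨r₀, hr₀⟩ : ∃ r₀, (1 - l) * r₀ = 1 := ⟨(1 - l)⁻¹, mul_inv_cancel₀ hη.ne'⟩
  have hr₀0 : 0 < r₀ := pos_of_mul_pos_right (by rw [hr₀]; exact one_pos) hη.le
  refine ⟨5 + 3 * r₀, fun τ hτ f hf => ?_⟩
  obtain ⟨M, -, hM⟩ := hf.exists_forall_ge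
  have hNM : ∀ r, max M r₀ ≤ r → f r = 0 ∧ deriv f r = 0 :=
    fun r hr => hM r ((le_max_left _ _).trans hr)
  have hleft := sub_le_integral_of_riccati hf.contDiff (V := fun r => (r - τ) ^ 2 - l)
    (W := fun r => (1 + l) / 2 * ((1 - l) * (τ - r₀)) * r ^ 2)
    (W' := fun r => (1 + l) / 2 * ((1 - l) * (τ - r₀)) * (2 * r)) le_rfl hr₀0.le (by fun_prop)
    (fun r => ((hasDerivAt_pow 2 r).const_mul _).congr_deriv (by simp)) (by fun_prop)
    fun r hr => riccati_near_zero hl0 hl1 hr.1.le (by nlinarith [hr.2]) (by nlinarith)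
      (by linarith [hr.2])
  have hright := sub_le_integral_of_riccati hf.contDiff (V := fun r => (r - τ) ^ 2 - l)
    (W := fun r => (1 + l) / 2 * (τ * r - r ^ 2) - 1 / 2)
    (W' := fun r => (1 + l) / 2 * (τ - 2 * r)) hr₀0.le (le_max_right M r₀) (by fun_prop)
    (fun r => (((((hasDerivAt_id r).const_mul τ).sub (hasDerivAt_pow 2 r)).const_mul
      ((1 + l) / 2)).sub_const (1 / 2)).congr_deriv (by simp)) (by fun_prop)
    fun r hr => riccati_near_infty hl0 hl1 (by nlinarith [hr.1])
  have hcont : Continuous fun r => (deriv f r ^ 2 + ((r - τ) ^ 2 - l) * f r ^ 2) * r := by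
    have hfc := hf.contDiff.continuous
    have hf'c := hf.continuous_deriv
    fun_prop
  have hjump : (1 + l) / 2 * ((1 - l) * (τ - r₀)) * r₀ ^ 2
      = (1 + l) / 2 * (τ * r₀ - r₀ ^ 2) := by
    linear_combination (1 + l) / 2 * (τ - r₀) * r₀ * hr₀
  rw [← sub_nonneg, radialEnergy_sub_mul_radialMass hf,
    setIntegral_Ioi_eq_intervalIntegral (hr₀0.le.trans (le_max_right M r₀)) fun r hr => by
      rw [(hNM r hr).1, (hNM r hr).2]; ring,
    ← intervalIntegral.integral_add_adjacent_intervals (hcont.intervalIntegrable 0 r₀)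
      (hcont.intervalIntegrable r₀ _)]
  simp only [hjump, (hNM _ le_rfl).1] at hleft hright
  nlinarith [sq_nonneg (f r₀)]

lemma radialMass_le_radialEnergy {τ : ℝ} (hτ : τ ≤ -1) {f : ℝ → ℝ} (hf : IsRadialTrial f) :
    radialMass f ≤ radialEnergy τ f := by
  refine setIntegral_mono_on hf.integrableOn_mass (hf.integrableOn_energy τ) measurableSet_Ioi
    fun r (hr : 0 < r) => mul_le_mul_of_nonneg_right ?_ hr.le
  exact (le_mul_of_one_le_left (sq_nonneg _) (by nlinarith)).trans
    (le_add_of_nonneg_left (sq_nonneg _))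

lemma radialMoment_le {f : ℝ → ℝ} (hf : IsRadialTrial f) (τ : ℝ) :
    radialMoment f ≤ 2 * radialEnergy τ f + 2 * τ ^ 2 * radialMass f := by
  rw [radialMoment, radialEnergy, radialMass, ← integral_const_mul, ← integral_const_mul,
    ← integral_add ((hf.integrableOn_energy τ).const_mul 2) (hf.integrableOn_mass.const_mul _)]
  refine setIntegral_mono_on (hf.integrableOn_norm_sq_mul_pow 3)
    (((hf.integrableOn_energy τ).const_mul 2).add (hf.integrableOn_mass.const_mul _))
    measurableSet_Ioi fun r (hr : 0 < r) => ?_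
  have hsq : r ^ 2 ≤ 2 * (r - τ) ^ 2 + 2 * τ ^ 2 := by nlinarith [sq_nonneg (r - 2 * τ)]
  calc ‖f r‖ ^ 2 * r ^ 3 = r ^ 2 * (‖f r‖ ^ 2 * r) := by ring
    _ ≤ (2 * (r - τ) ^ 2 + 2 * τ ^ 2) * (‖f r‖ ^ 2 * r) :=
      mul_le_mul_of_nonneg_right hsq (by positivity)
    _ ≤ _ := by nlinarith [mul_nonneg (sq_nonneg ‖deriv f r‖) hr.le]

lemma exists_forall_radialMoment_le {l : ℝ} (hl0 : 0 ≤ l) (hl1 : l < 1) :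
    ∃ κ, 0 ≤ κ ∧ ∀ (τ : ℝ) (f : ℝ → ℝ), IsRadialTrial f → radialEnergy τ f < l * radialMass f →
      radialMoment f ≤ κ * radialMass f := by
  obtain ⟨T, hT⟩ := exists_forall_mul_radialMass_le_radialEnergy hl0 hl1
  refine ⟨2 + 2 * (1 + T ^ 2), by positivity, fun τ f hf hlt => ?_⟩
  have hmass := radialMass_nonneg f
  have hτT : τ < T := not_le.1 fun h => (hT τ h f hf).not_gt hlt
  have hτ1 : -1 < τ := not_le.1 fun h => by nlinarith [radialMass_le_radialEnergy h hf]
  have hτsq : τ ^ 2 ≤ 1 + T ^ 2 := by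
    rcases le_total 0 τ with hτ0 | hτ0 <;> nlinarith
  nlinarith [radialMoment_le hf τ]

end LowerBound

section ExplicitTrial

lemma hasDerivAt_max_zero_sq (s : ℝ) :
    HasDerivAt (fun s : ℝ => max 0 s ^ 2) (2 * max 0 s) s := by
  rcases lt_trichotomy s 0 with h | rfl | h
  · rw [max_eq_left h.le, mul_zero]
    refine (hasDerivAt_const s (0 : ℝ)).congr_of_eventuallyEq ?_
    filter_upwards [gt_mem_nhds h] with y hy
    rw [max_eq_left hy.le, zero_pow two_ne_zero]
  · rw [hasDerivAt_iff_tendsto_slope, max_self, mul_zero]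
    have hcont : Continuous fun s : ℝ => max 0 s := by fun_prop
    refine ((hcont.tendsto' 0 0 (max_self 0)).mono_left nhdsWithin_le_nhds).congr' ?_
    filter_upwards [self_mem_nhdsWithin] with s (hs : s ≠ 0)
    rw [slope_def_field, max_self, zero_pow two_ne_zero, sub_zero, sub_zero, eq_div_iff hs]
    rcases le_total 0 s with h | h
    · rw [max_eq_right h, sq]
    · rw [max_eq_left h, zero_mul, zero_pow two_ne_zero]
  · rw [max_eq_right h.le]
    refine ((hasDerivAt_pow 2 s).congr_of_eventuallyEq ?_).congr_deriv (by norm_num)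
    filter_upwards [lt_mem_nhds h] with y hy
    rw [max_eq_right hy.le]

lemma integral_sum_mul_pow (n : ℕ) (c : Fin n → ℝ) (b : ℝ) :
    ∫ r in (0 : ℝ)..b, ∑ i, c i * r ^ (i : ℕ)
      = ∑ i, c i * (b ^ ((i : ℕ) + 1) / ((i : ℕ) + 1)) := by
  have hint : ∀ i : Fin n, IntervalIntegrable (fun r => c i * r ^ (i : ℕ)) volume 0 b :=
    fun i => (continuous_const.mul (continuous_pow _)).intervalIntegrable _ _
  rw [intervalIntegral.integral_finsetSum fun i _ => hint i]
  simp only [intervalIntegral.integral_const_mul, integral_pow, zero_pow (Nat.succ_ne_zero _),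
    sub_zero]

/-- A `C¹` function supported in `[-4, 4]`, whose energy at `τ = 3 / 2` is about `0.9004` times its
mass; what matters is that this is less than `1`. -/
def radialBump (r : ℝ) : ℝ := max 0 (1 - r ^ 2 / 16) ^ 2

lemma hasDerivAt_radialBump (r : ℝ) :
    HasDerivAt radialBump (2 * max 0 (1 - r ^ 2 / 16) * (-(r / 8))) r := by
  have hinner : HasDerivAt (fun r : ℝ => 1 - r ^ 2 / 16) (-(r / 8)) r :=
    (((hasDerivAt_pow 2 r).div_const 16).const_sub 1).congr_deriv (by norm_num; ring)
  exact (hasDerivAt_max_zero_sq (1 - r ^ 2 / 16)).comp r hinner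

lemma deriv_radialBump : deriv radialBump = fun r => 2 * max 0 (1 - r ^ 2 / 16) * (-(r / 8)) :=
  funext fun r => (hasDerivAt_radialBump r).deriv

lemma radialBump_eq_zero {r : ℝ} (hr : 4 ≤ r) : radialBump r = 0 ∧ deriv radialBump r = 0 := by
  have hmax : max 0 (1 - r ^ 2 / 16) = 0 := max_eq_left (by nlinarith)
  simp only [radialBump, deriv_radialBump, hmax, zero_pow two_ne_zero, mul_zero, zero_mul,
    and_self]

lemma isRadialTrial_radialBump : IsRadialTrial radialBump where
  contDiff := contDiff_one_iff_deriv.2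
    ⟨fun r => (hasDerivAt_radialBump r).differentiableAt, by rw [deriv_radialBump]; fun_prop⟩
  eventually_eq_zero := Filter.eventually_atTop.2 ⟨4, fun _ hr => (radialBump_eq_zero hr).1⟩

lemma max_zero_eq_of_mem_uIcc {r : ℝ} (hr : r ∈ uIcc (0 : ℝ) 4) :
    max 0 (1 - r ^ 2 / 16) = 1 - r ^ 2 / 16 := by
  rw [uIcc_of_le (by norm_num)] at hr
  exact max_eq_right (by nlinarith [hr.1, hr.2])

lemma radialMass_radialBump : radialMass radialBump = 8 / 5 := by
  have hpoly : ∀ r ∈ uIcc (0 : ℝ) 4, ‖radialBump r‖ ^ 2 * r = ∑ i : Fin 10,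
      (![0, 1, 0, -1/4, 0, 3/128, 0, -1/1024, 0, 1/65536] : Fin 10 → ℝ) i * r ^ (i : ℕ) := by
    intro r hr
    rw [Real.norm_eq_abs, sq_abs, radialBump, max_zero_eq_of_mem_uIcc hr]
    norm_num [Fin.sum_univ_succ]
    ring
  rw [radialMass, setIntegral_Ioi_eq_intervalIntegral (M := 4) (by norm_num) fun r hr => by
    rw [(radialBump_eq_zero hr).1, norm_zero, zero_pow two_ne_zero, zero_mul],
    intervalIntegral.integral_congr hpoly, integral_sum_mul_pow]
  norm_num [Fin.sum_univ_succ]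

lemma radialEnergy_radialBump_lt : radialEnergy (3 / 2) radialBump < 8 / 5 := by
  have hpoly : ∀ r ∈ uIcc (0 : ℝ) 4,
      (‖deriv radialBump r‖ ^ 2 + (r - 3 / 2) ^ 2 * ‖radialBump r‖ ^ 2) * r = ∑ i : Fin 12,
        (![0, 9/4, -3, 1/2, 3/4, -105/512, -9/128, 11/512, 3/1024, -247/262144, -3/65536,
          1/65536] : Fin 12 → ℝ) i * r ^ (i : ℕ) := by
    intro r hr
    rw [Real.norm_eq_abs, Real.norm_eq_abs, sq_abs, sq_abs, radialBump, deriv_radialBump]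
    simp only [max_zero_eq_of_mem_uIcc hr]
    norm_num [Fin.sum_univ_succ]
    ring
  rw [radialEnergy, setIntegral_Ioi_eq_intervalIntegral (M := 4) (by norm_num) fun r hr => by
    rw [(radialBump_eq_zero hr).1, (radialBump_eq_zero hr).2, norm_zero]; ring,
    intervalIntegral.integral_congr hpoly, integral_sum_mul_pow]
  norm_num [Fin.sum_univ_succ]

end ExplicitTrial

section LpConvergence

variable {X E : Type*} [MeasurableSpace X] {μ : Measure X} [NormedAddCommGroup E]

lemma eLpNorm_two_sq (f : X → E) : eLpNorm f 2 μ ^ 2 = ∫⁻ x, ‖f x‖ₑ ^ 2 ∂μ := by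
  have h := eLpNorm_nnreal_pow_eq_lintegral (f := f) (μ := μ) (p := 2) two_ne_zero
  simpa only [NNReal.coe_ofNat, ENNReal.coe_ofNat, ENNReal.rpow_ofNat] using h

lemma tendsto_eLpNorm_two_zero_of_dominated {F : ℕ → X → E} {b : X → ℝ} (hb : MemLp b 2 μ)
    (hF : ∀ n, AEStronglyMeasurable (F n) μ) (hFb : ∀ n, ∀ᵐ x ∂μ, ‖F n x‖ ≤ b x)
    (hlim : ∀ᵐ x ∂μ, Filter.Tendsto (fun n => F n x) Filter.atTop (nhds 0)) :
    Filter.Tendsto (fun n => eLpNorm (F n) 2 μ) Filter.atTop (nhds 0) := by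
  have hsq : Filter.Tendsto (fun n => eLpNorm (F n) 2 μ ^ 2) Filter.atTop (nhds 0) := by
    simp_rw [eLpNorm_two_sq]
    rw [← lintegral_zero (μ := μ)]
    refine tendsto_lintegral_of_dominated_convergence' (fun x => ‖b x‖ₑ ^ 2)
      (fun n => (hF n).enorm.pow_const 2) (fun n => ?_) ?_ ?_
    · filter_upwards [hFb n] with x hx
      gcongr
      exact enorm_le_iff_norm_le.2 (hx.trans (le_abs_self _))
    · rw [← eLpNorm_two_sq]
      exact ENNReal.pow_ne_top hb.2.ne
    · filter_upwards [hlim] with x hx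
      have hx2 := ENNReal.Tendsto.pow (n := 2) hx.enorm
      rwa [enorm_zero, zero_pow two_ne_zero] at hx2
  have hroot := hsq.ennrpow_const 2⁻¹
  simp_rw [← ENNReal.rpow_two, ENNReal.rpow_rpow_inv (two_ne_zero' ℝ)] at hroot
  rwa [ENNReal.zero_rpow_of_pos (by norm_num)] at hroot

variable [NormedSpace ℝ E]

lemma tendsto_toLp_smul {c : ℕ → X → ℝ} {C l : ℝ} (hc : ∀ n x, |c n x| ≤ C)
    (hlim : ∀ x, Filter.Tendsto (fun n => c n x) Filter.atTop (nhds l)) (v : Lp E 2 μ)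
    (hcv : ∀ n, MemLp (fun x => c n x • v x) 2 μ) :
    Filter.Tendsto (fun n => (hcv n).toLp) Filter.atTop (nhds (l • v)) := by
  have hv : MemLp (fun x => l • v x) 2 μ := (Lp.memLp v).const_smul l
  have hlv : hv.toLp = l • v := Lp.ext <| by
    filter_upwards [hv.coeFn_toLp, Lp.coeFn_smul l v] with x hx hx'
    rw [hx, hx', Pi.smul_apply]
  rw [← hlv, Lp.tendsto_Lp_iff_tendsto_eLpNorm'']
  refine tendsto_eLpNorm_two_zero_of_dominated ((Lp.memLp v).norm.const_mul (C + |l|))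
    (fun n => ((hcv n).sub hv).aestronglyMeasurable) (fun n => .of_forall fun x => ?_)
    (.of_forall fun x => ?_)
  · rw [Pi.sub_apply, ← sub_smul, norm_smul, Real.norm_eq_abs]
    gcongr
    exact (abs_sub _ _).trans (add_le_add_left (hc n x) _)
  · simpa using ((hlim x).smul_const (v x)).sub_const (l • v x)

end LpConvergence

section RadialMeasure

lemma ae_radialMeasure_iff {p : ℝ → Prop} :
    (∀ᵐ r ∂radialMeasure, p r) ↔ ∀ᵐ r ∂(volume.restrict (Ioi (0 : ℝ))), p r := by
  rw [radialMeasure, ae_withDensity_iff ENNReal.measurable_ofReal]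
  refine ⟨fun h => ?_, fun h => h.mono fun r hr _ => hr⟩
  filter_upwards [h, ae_restrict_mem measurableSet_Ioi] with r hr hr0
  exact hr (by simpa using hr0)

lemma ae_radialMeasure_pos : ∀ᵐ r ∂radialMeasure, 0 < r :=
  ae_radialMeasure_iff.2 (ae_restrict_mem measurableSet_Ioi)

lemma lintegral_radialMeasure (F : ℝ → ENNReal) :
    ∫⁻ r, F r ∂radialMeasure = ∫⁻ r in Ioi (0 : ℝ), ENNReal.ofReal r * F r := by
  rw [radialMeasure, lintegral_withDensity_eq_lintegral_mul_non_measurable _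
    ENNReal.measurable_ofReal (.of_forall fun r => ENNReal.ofReal_lt_top)]
  rfl

lemma integral_radialMeasure (F : ℝ → ℝ) :
    ∫ r, F r ∂radialMeasure = ∫ r in Ioi (0 : ℝ), F r * r := by
  rw [radialMeasure, integral_withDensity_eq_integral_toReal_smul ENNReal.measurable_ofReal
    (.of_forall fun r => ENNReal.ofReal_lt_top)]
  refine setIntegral_congr_fun measurableSet_Ioi fun r (hr : 0 < r) => ?_
  simp only [ENNReal.toReal_ofReal hr.le, smul_eq_mul, mul_comm]

lemma restrict_Ioi_le_smul_radialMeasure {δ : ℝ} (hδ : 0 < δ) :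
    volume.restrict (Ioi δ) ≤ ENNReal.ofReal δ⁻¹ • radialMeasure := by
  rw [Measure.le_iff]
  intro s hs
  rw [Measure.smul_apply, smul_eq_mul, radialMeasure, withDensity_apply _ hs,
    Measure.restrict_restrict hs, Measure.restrict_apply hs]
  have hδs : ENNReal.ofReal δ * volume (s ∩ Ioi δ) ≤ ∫⁻ r in s ∩ Ioi 0, ENNReal.ofReal r := by
    rw [← setLIntegral_const]
    exact (setLIntegral_mono' (hs.inter measurableSet_Ioi) fun r hr =>
      ENNReal.ofReal_le_ofReal (le_of_lt hr.2)).trans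
        (lintegral_mono_set (inter_subset_inter_right _ (Ioi_subset_Ioi hδ.le)))
  calc volume (s ∩ Ioi δ) = ENNReal.ofReal δ⁻¹ * (ENNReal.ofReal δ * volume (s ∩ Ioi δ)) := by
        rw [← mul_assoc, ← ENNReal.ofReal_mul (by positivity), inv_mul_cancel₀ hδ.ne',
          ENNReal.ofReal_one, one_mul]
    _ ≤ _ := by gcongr

instance : IsLocallyFiniteMeasure radialMeasure :=
  IsLocallyFiniteMeasure.withDensity_ofReal continuous_id

variable {E : Type*} [NormedAddCommGroup E]

lemma memLp_radialMeasure_of_continuous {F : ℝ → E} (hF : Continuous F) {M : ℝ}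
    (hM : ∀ r, M ≤ r → F r = 0) (p : ENNReal) : MemLp F p radialMeasure := by
  refine memLp_of_continuous_of_ae_eq_zero_off_compact hF (isCompact_Icc (a := 0) (b := M)) ?_ p
  filter_upwards [ae_radialMeasure_pos] with r hr hrM
  exact hM r (not_lt.1 fun h => hrM ⟨hr.le, h.le⟩)

variable [NormedSpace ℝ E]

lemma integrableOn_Ioi_continuous_smul {a : ℝ → ℝ} (ha : Continuous a) {M : ℝ}
    (hM : ∀ r, M ≤ r → a r = 0) {u : ℝ → E} (hu : MemLp u 2 radialMeasure) {δ : ℝ}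
    (hδ : 0 < δ) : IntegrableOn (fun r => a r • u r) (Ioi δ) := by
  have hu' : MemLp u 2 (volume.restrict (Ioi δ)) :=
    hu.of_measure_le_smul ENNReal.ofReal_ne_top (restrict_Ioi_le_smul_radialMeasure hδ)
  have ha' : MemLp a 2 (volume.restrict (Ioi δ)) := by
    refine memLp_of_continuous_of_ae_eq_zero_off_compact ha (isCompact_Icc (a := δ) (b := M)) ?_ 2
    filter_upwards [ae_restrict_mem measurableSet_Ioi] with r (hr : δ < r) hrM
    exact hM r (not_lt.1 fun h => hrM ⟨hr.le, h.le⟩)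
  exact memLp_one_iff_integrable.1 (hu'.smul ha')

end RadialMeasure

section Primitive

variable {E : Type*} [NormedAddCommGroup E] [NormedSpace ℝ E]

lemma setIntegral_smul_integral_Ioi [CompleteSpace E] {ψ : ℝ → ℝ} {G : ℝ → E} {a : ℝ}
    (hψ : IntegrableOn ψ (Ioi a)) (hG : IntegrableOn G (Ioi a)) :
    ∫ s in Ioi a, ψ s • ∫ r in Ioi s, G r = ∫ r in Ioi a, (∫ s in a..r, ψ s) • G r := by
  have hT : MeasurableSet {p : ℝ × ℝ | p.1 ≤ p.2} := measurableSet_le measurable_fst measurable_snd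
  have hint : Integrable (Function.uncurry fun s r =>
      {p : ℝ × ℝ | p.1 ≤ p.2}.indicator (fun p => ψ p.1 • G p.2) (s, r))
      ((volume.restrict (Ioi a)).prod (volume.restrict (Ioi a))) :=
    (hψ.smul_prod hG).indicator hT
  have hswap := integral_integral_swap hint
  have hleft : ∀ s ∈ Ioi a, (∫ r in Ioi a, {p : ℝ × ℝ | p.1 ≤ p.2}.indicator
      (fun p => ψ p.1 • G p.2) (s, r)) = ψ s • ∫ r in Ioi s, G r := fun s hs => by
    have hIci : Ioi a ∩ Ici s = Ici s := inter_eq_right.2 (Ici_subset_Ioi.2 hs)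
    rw [← integral_Ici_eq_integral_Ioi (x := s), ← hIci, ← setIntegral_indicator measurableSet_Ici,
      ← integral_smul]
    refine integral_congr_ae (.of_forall fun r => ?_)
    by_cases hsr : s ≤ r <;> simp [indicator, hsr]
  have hright : ∀ r ∈ Ioi a, (∫ s in Ioi a, {p : ℝ × ℝ | p.1 ≤ p.2}.indicator
      (fun p => ψ p.1 • G p.2) (s, r)) = (∫ s in a..r, ψ s) • G r := fun r hr => by
    rw [intervalIntegral.integral_of_le (le_of_lt hr), ← Ioi_inter_Iic,
      ← setIntegral_indicator measurableSet_Iic, ← integral_smul_const]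
    refine integral_congr_ae (.of_forall fun s => ?_)
    by_cases hsr : s ≤ r <;> simp [indicator, hsr]
  rwa [setIntegral_congr_fun measurableSet_Ioi hleft,
    setIntegral_congr_fun measurableSet_Ioi hright] at hswap

lemma contDiff_primitive {ψ : ℝ → ℝ} (hψ : ContDiff ℝ ∞ ψ) (a : ℝ) :
    ContDiff ℝ ∞ fun r => ∫ s in a..r, ψ s := by
  rw [contDiff_infty_iff_deriv]
  refine ⟨fun r => (hψ.continuous.integral_hasStrictDerivAt a r).hasDerivAt.differentiableAt, ?_⟩
  rwa [show deriv (fun r => ∫ s in a..r, ψ s) = ψ from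
    funext fun r => hψ.continuous.deriv_integral _ a r]

/- The du Bois-Reymond lemma for functions integrable up to `+∞`: the test functions need not vanish
near `+∞`, which fixes the constant of integration. -/
lemma ae_eq_neg_integral_Ioi_of_integral_deriv_smul [CompleteSpace E] {v G : ℝ → E} {a : ℝ}
    (hv : IntegrableOn v (Ioi a)) (hG : IntegrableOn G (Ioi a))
    (h : ∀ φ : ℝ → ℝ, ContDiff ℝ ∞ φ → (∀ r, r ≤ a → φ r = 0) →
      ∫ r in Ioi a, deriv φ r • v r = -∫ r in Ioi a, φ r • G r) :
    ∀ᵐ r, r ∈ Ioi a → v r = -∫ s in Ioi r, G s := by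
  have hP : LocallyIntegrable (fun r => ∫ s in Ioi r, G s) (volume.restrict (Ioi a)) := by
    rw [restrict_Ioi_eq_restrict_Ici,
      ← locallyIntegrableOn_iff_locallyIntegrable_restrict isClosed_Ici]
    exact (hG.continuousOn_Ici_primitive_Ioi).locallyIntegrableOn measurableSet_Ici
  have hloc : LocallyIntegrableOn (fun r => v r + ∫ s in Ioi r, G s) (Ioi a) :=
    hv.locallyIntegrableOn.add (locallyIntegrableOn_of_locallyIntegrable_restrict hP)
  suffices ∀ ψ : ℝ → ℝ, ContDiff ℝ ∞ ψ → HasCompactSupport ψ → tsupport ψ ⊆ Ioi a →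
      ∫ r, ψ r • (v r + ∫ s in Ioi r, G s) = 0 by
    filter_upwards [isOpen_Ioi.ae_eq_zero_of_integral_contDiff_smul_eq_zero hloc this] with r hr hra
    exact eq_neg_of_add_eq_zero_left (hr hra)
  intro ψ hψ hψc hψa
  have hψ0 : ∀ r, r ≤ a → ψ r = 0 := fun r hr =>
    image_eq_zero_of_notMem_tsupport fun hmem => not_lt.2 hr (hψa hmem)
  have hφ0 : ∀ r, r ≤ a → ∫ s in a..r, ψ s = 0 := fun r hr => by
    rw [intervalIntegral.integral_of_ge hr, setIntegral_eq_zero_of_forall_eq_zero fun s hs =>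
      hψ0 s hs.2, neg_zero]
  have hweak := h _ (contDiff_primitive hψ a) hφ0
  simp_rw [hψ.continuous.deriv_integral _ a] at hweak
  have hψint : IntegrableOn ψ (Ioi a) :=
    (hψ.continuous.integrable_of_hasCompactSupport hψc).integrableOn
  have hψv : IntegrableOn (fun r => ψ r • v r) (Ioi a) :=
    Integrable.locallyIntegrable hv |>.integrable_smul_left_of_hasCompactSupport hψ.continuous hψc
  have hψP : IntegrableOn (fun r => ψ r • ∫ s in Ioi r, G s) (Ioi a) :=
    hP.integrable_smul_left_of_hasCompactSupport hψ.continuous hψc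
  rw [← setIntegral_eq_integral_of_forall_compl_eq_zero (s := Ioi a) fun r hr => by
    rw [hψ0 r (not_lt.1 hr), zero_smul]]
  simp_rw [smul_add]
  rw [integral_add hψv hψP, setIntegral_smul_integral_Ioi hψint hG, hweak, neg_add_cancel]

end Primitive

section WeakDeriv

variable {u g : L2r}

lemma IsWeakDeriv.setIntegral_deriv_smul (hug : IsWeakDeriv u g) {φ : ℝ → ℝ}
    (hφ : ContDiff ℝ ∞ φ) {δ M : ℝ} (hδ : 0 < δ) (hφδ : ∀ r, r ≤ δ → φ r = 0)
    (hφM : ∀ r, M ≤ r → φ r = 0) :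
    ∫ r in Ioi δ, deriv φ r • u r = -∫ r in Ioi δ, φ r • g r := by
  have hsupp : Function.support (fun r => (φ r : ℂ)) ⊆ Icc δ M := fun r hr =>
    ⟨not_lt.1 fun h => hr (by simp [hφδ r h.le]), not_lt.1 fun h => hr (by simp [hφM r h.le])⟩
  have hderiv : ∀ r, deriv (fun r => (φ r : ℂ)) r = ((deriv φ r : ℝ) : ℂ) := fun r =>
    (hφ.differentiable (by simp) r).hasDerivAt.ofReal_comp.deriv
  have hweak := hug (fun r => (φ r : ℂ)) (Complex.ofRealCLM.contDiff.comp hφ)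
    (.of_support_subset_isCompact isCompact_Icc hsupp)
    ((closure_minimal hsupp isClosed_Icc).trans fun r hr => hδ.trans_le hr.1)
  have hderiv0 : ∀ r, r < δ → deriv φ r = 0 := fun r hr => by
    have hloc : φ =ᶠ[nhds r] fun _ => 0 := by
      filter_upwards [Iio_mem_nhds hr] with s hs using hφδ s (le_of_lt hs)
    rw [hloc.deriv_eq, deriv_const]
  rw [setIntegral_eq_of_subset_of_ae_sdiff_eq_zero (s := Ioi δ)
      measurableSet_Ioi.nullMeasurableSet (Ioi_subset_Ioi hδ.le),
    setIntegral_eq_of_subset_of_forall_sdiff_eq_zero (s := Ioi δ) measurableSet_Ioi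
      (Ioi_subset_Ioi hδ.le)] at hweak
  · simpa only [hderiv, Complex.real_smul, mul_comm] using hweak
  · intro r hr
    rw [hφδ r (not_lt.1 hr.2), Complex.ofReal_zero, mul_zero]
  · filter_upwards [Measure.ae_ne volume δ] with r hr hrδ
    rw [hderiv, hderiv0 r (lt_of_le_of_ne (not_lt.1 hrδ.2) hr), Complex.ofReal_zero, mul_zero]

/-- The weak derivative of `χ u`, where `g` is the weak derivative of `u`. -/
def cutoffDeriv (χ : ℝ → ℝ) (u g : ℝ → ℂ) (r : ℝ) : ℂ :=
  χ r • g r + deriv χ r • u r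

variable {χ : ℝ → ℝ} {M : ℝ}

lemma IsWeakDeriv.ae_cutoff_eq_primitive (hug : IsWeakDeriv u g) (hχ : ContDiff ℝ ∞ χ)
    (hM : ∀ r, M ≤ r → χ r = 0) :
    ∀ᵐ r ∂radialMeasure, χ r • u r = -∫ s in Ioi r, cutoffDeriv χ u g s := by
  have hM' : ∀ r, M + 1 ≤ r → χ r = 0 ∧ deriv χ r = 0 := fun r hr =>
    ⟨hM r (by linarith), deriv_eq_zero_of_forall_ge hM (by linarith)⟩
  have hχ' : Continuous (deriv χ) := hχ.continuous_deriv (by simp)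
  have key : ∀ δ > 0, ∀ᵐ r, r ∈ Ioi δ → χ r • u r = -∫ s in Ioi r, cutoffDeriv χ u g s := by
    intro δ hδ
    have hint : ∀ {a : ℝ → ℝ} (v : L2r), Continuous a → (∀ r, M + 1 ≤ r → a r = 0) →
        IntegrableOn (fun r => a r • v r) (Ioi δ) := fun v ha haM =>
      integrableOn_Ioi_continuous_smul ha haM (Lp.memLp v) hδ
    refine ae_eq_neg_integral_Ioi_of_integral_deriv_smul
      (hint u hχ.continuous fun r hr => (hM' r hr).1)
      ((hint g hχ.continuous fun r hr => (hM' r hr).1).add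
        (hint u hχ' fun r hr => (hM' r hr).2)) fun φ hφ hφδ => ?_
    have hweak := hug.setIntegral_deriv_smul (M := M) (hχ.mul hφ) hδ
      (fun r hr => by simp [hφδ r hr])
      (fun r hr => by simp [hM r hr])
    have hφ' : Continuous (deriv φ) := hφ.continuous_deriv (by simp)
    have hχφ : ∀ r, deriv (fun x => χ x * φ x) r = deriv χ r * φ r + χ r * deriv φ r := fun r =>
      deriv_fun_mul (hχ.differentiable (by simp) r) (hφ.differentiable (by simp) r)
    have iχ'φu := hint u (hχ'.mul hφ.continuous) fun r hr => by simp [hM' r hr]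
    have iχφ'u := hint u (hχ.continuous.mul hφ') fun r hr => by simp [hM' r hr]
    have iχφg := hint g (hχ.continuous.mul hφ.continuous) fun r hr => by simp [hM' r hr]
    simp only [hχφ, add_smul, Pi.mul_apply] at hweak iχ'φu iχφ'u iχφg
    rw [integral_add iχ'φu iχφ'u] at hweak
    simp only [cutoffDeriv, smul_add, smul_smul, mul_comm (φ _), mul_comm (deriv φ _)]
    rw [integral_add iχφg iχ'φu]
    linear_combination hweak
  have hall : ∀ᵐ r, ∀ n : ℕ, r ∈ Ioi (1 / ((n : ℝ) + 1)) →
      χ r • u r = -∫ s in Ioi r, cutoffDeriv χ u g s :=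
    ae_all_iff.2 fun n => key _ (by positivity)
  rw [ae_radialMeasure_iff, ae_restrict_iff' measurableSet_Ioi]
  filter_upwards [hall] with r hr hr0
  obtain ⟨n, hn⟩ := exists_nat_one_div_lt (show (0 : ℝ) < r from hr0)
  exact hr n hn

end WeakDeriv

section Hardy

variable {E : Type*} [NormedAddCommGroup E] {k : ℝ → E} {M : ℝ}

lemma eLpNorm_one_restrict_Ioc_sq_le {s : ℝ} (hs : 0 < s)
    (hk : AEStronglyMeasurable k (volume.restrict (Ioi 0))) :
    eLpNorm k 1 (volume.restrict (Ioc s M)) ^ 2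
      ≤ ENNReal.ofReal s⁻¹ * (ENNReal.ofReal M * eLpNorm k 2 radialMeasure ^ 2) := by
  have hsM : volume.restrict (Ioc s M) ≤ volume.restrict (Ioi s) :=
    Measure.restrict_mono Ioc_subset_Ioi_self le_rfl
  have hk' : AEStronglyMeasurable k (volume.restrict (Ioc s M)) :=
    hk.mono_measure (hsM.trans (Measure.restrict_mono (Ioi_subset_Ioi hs.le) le_rfl))
  have hCS := eLpNorm_le_eLpNorm_mul_rpow_measure_univ (p := 1) (q := 2) (by norm_num) hk'
  rw [Measure.restrict_apply_univ, Real.volume_Ioc] at hCS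
  have hweight : eLpNorm k 2 (volume.restrict (Ioc s M)) ^ 2
      ≤ ENNReal.ofReal s⁻¹ * eLpNorm k 2 radialMeasure ^ 2 := by
    rw [eLpNorm_two_sq, eLpNorm_two_sq, ← smul_eq_mul, ← lintegral_smul_measure]
    exact lintegral_mono' (hsM.trans (restrict_Ioi_le_smul_radialMeasure hs)) le_rfl
  calc eLpNorm k 1 (volume.restrict (Ioc s M)) ^ 2
      ≤ eLpNorm k 2 (volume.restrict (Ioc s M)) ^ 2 * ENNReal.ofReal (M - s) := by
        refine (pow_le_pow_left' hCS 2).trans_eq ?_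
        rw [mul_pow, ← ENNReal.rpow_natCast (_ ^ _), ← ENNReal.rpow_mul]
        norm_num
    _ ≤ ENNReal.ofReal s⁻¹ * eLpNorm k 2 radialMeasure ^ 2 * ENNReal.ofReal M := by
        gcongr
        linarith
    _ = _ := by ring

variable [NormedSpace ℝ E]

lemma eLpNorm_primitive_le (hk : AEStronglyMeasurable k (volume.restrict (Ioi 0)))
    (hM : ∀ r, M ≤ r → k r = 0) :
    eLpNorm (fun s => ∫ r in Ioi s, k r) 2 radialMeasure
      ≤ ENNReal.ofReal M * eLpNorm k 2 radialMeasure := by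
  set I := eLpNorm k 2 radialMeasure
  have hpointwise : ∀ s ∈ Ioi (0 : ℝ), ENNReal.ofReal s * ‖∫ r in Ioi s, k r‖ₑ ^ 2
      ≤ (Ioc 0 M).indicator (fun _ => ENNReal.ofReal M * I ^ 2) s := by
    intro s (hs : 0 < s)
    have hIoc : ∫ r in Ioi s, k r = ∫ r in Ioc s M, k r :=
      setIntegral_eq_of_subset_of_forall_sdiff_eq_zero measurableSet_Ioi Ioc_subset_Ioi_self
        fun r hr => hM r (not_lt.1 fun hrM => hr.2 ⟨hr.1, hrM.le⟩)
    rcases le_or_gt s M with hsM | hsM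
    · rw [indicator_of_mem (show s ∈ Ioc 0 M from ⟨hs, hsM⟩), hIoc]
      calc ENNReal.ofReal s * ‖∫ r in Ioc s M, k r‖ₑ ^ 2
          ≤ ENNReal.ofReal s * (ENNReal.ofReal s⁻¹ * (ENNReal.ofReal M * I ^ 2)) := by
            gcongr
            refine le_trans ?_ (eLpNorm_one_restrict_Ioc_sq_le hs hk)
            rw [eLpNorm_one_eq_lintegral_enorm]
            gcongr
            exact enorm_integral_le_lintegral_enorm _
        _ = ENNReal.ofReal M * I ^ 2 := by
            rw [← mul_assoc, ← ENNReal.ofReal_mul hs.le, mul_inv_cancel₀ hs.ne',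
              ENNReal.ofReal_one, one_mul]
    · simp [hIoc, Ioc_eq_empty hsM.not_gt]
  refine (ENNReal.pow_le_pow_left_iff two_ne_zero).1 ?_
  calc eLpNorm (fun s => ∫ r in Ioi s, k r) 2 radialMeasure ^ 2
      = ∫⁻ s in Ioi 0, ENNReal.ofReal s * ‖∫ r in Ioi s, k r‖ₑ ^ 2 := by
        rw [eLpNorm_two_sq, lintegral_radialMeasure]
    _ ≤ ∫⁻ s, (Ioc 0 M).indicator (fun _ => ENNReal.ofReal M * I ^ 2) s :=
        (setLIntegral_mono' measurableSet_Ioi hpointwise).trans (setLIntegral_le_lintegral _ _)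
    _ = (ENNReal.ofReal M * I) ^ 2 := by
        rw [lintegral_indicator measurableSet_Ioc, setLIntegral_const, Real.volume_Ioc, sub_zero]
        ring

end Hardy

section Cutoff

/-- A smooth function of `r`, equal to `1` for `r ≤ a` and to `0` for `r ≥ a + 1`, which truncates
functions on the half-line. -/
def cutoff (a r : ℝ) : ℝ := 1 - Real.smoothTransition (r - a)

lemma contDiff_cutoff (a : ℝ) : ContDiff ℝ ∞ (cutoff a) :=
  contDiff_const.sub (Real.smoothTransition.contDiff.comp (contDiff_id.sub contDiff_const))

lemma cutoff_of_le {a r : ℝ} (h : r ≤ a) : cutoff a r = 1 := by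
  rw [cutoff, Real.smoothTransition.zero_of_nonpos (by linarith), sub_zero]

lemma cutoff_of_ge {a r : ℝ} (h : a + 1 ≤ r) : cutoff a r = 0 := by
  rw [cutoff, Real.smoothTransition.one_of_one_le (by linarith), sub_self]

lemma abs_cutoff_le (a r : ℝ) : |cutoff a r| ≤ 1 := by
  rw [cutoff, abs_le]
  constructor <;> linarith [Real.smoothTransition.nonneg (r - a),
    Real.smoothTransition.le_one (r - a)]

lemma deriv_cutoff (a r : ℝ) : deriv (cutoff a) r = -deriv Real.smoothTransition (r - a) := by
  simp only [funext fun r => cutoff.eq_1 a r, deriv_const_sub, deriv_comp_sub_const]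

lemma deriv_cutoff_of_lt {a r : ℝ} (h : r < a) : deriv (cutoff a) r = 0 := by
  have hloc : cutoff a =ᶠ[nhds r] fun _ => 1 := by
    filter_upwards [gt_mem_nhds h] with s hs using cutoff_of_le (le_of_lt hs)
  rw [hloc.deriv_eq, deriv_const]

lemma exists_abs_deriv_cutoff_le : ∃ C, ∀ a r, |deriv (cutoff a) r| ≤ C := by
  have hcont : Continuous (deriv Real.smoothTransition) :=
    (Real.smoothTransition.contDiff (n := 1)).continuous_deriv le_rfl
  obtain ⟨C, hC⟩ := isCompact_Icc.exists_bound_of_continuousOn (s := Icc (0 : ℝ) 1)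
    hcont.continuousOn
  have hC0 : 0 ≤ C := (norm_nonneg _).trans (hC 0 (by simp))
  refine ⟨C, fun a r => ?_⟩
  rcases lt_or_ge r a with hra | har
  · rwa [deriv_cutoff_of_lt hra, abs_zero]
  rcases lt_or_ge (a + 1) r with har' | hra'
  · rwa [deriv_eq_zero_of_forall_ge (fun s hs => cutoff_of_ge hs) har', abs_zero]
  · rw [deriv_cutoff, abs_neg]
    exact hC _ ⟨by linarith, by linarith⟩

lemma tendsto_cutoff_natCast (r : ℝ) :
    Filter.Tendsto (fun n : ℕ => cutoff n r) Filter.atTop (nhds 1) := by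
  refine tendsto_const_nhds.congr' ?_
  filter_upwards [tendsto_natCast_atTop_atTop.eventually_ge_atTop r] with n hn
  exact (cutoff_of_le hn).symm

lemma tendsto_deriv_cutoff_natCast (r : ℝ) :
    Filter.Tendsto (fun n : ℕ => deriv (cutoff n) r) Filter.atTop (nhds 0) := by
  refine tendsto_const_nhds.congr' ?_
  filter_upwards [tendsto_natCast_atTop_atTop.eventually_gt_atTop r] with n hn
  exact (deriv_cutoff_of_lt hn).symm

end Cutoff

section Approximation

variable {E : Type*} [NormedAddCommGroup E] [NormedSpace ℝ E] {G : ℝ → E} {M : ℝ}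

lemma integrableOn_Ioi_of_memLp_radialMeasure (hG : MemLp G 2 radialMeasure)
    (hM : ∀ r, M ≤ r → G r = 0) {δ : ℝ} (hδ : 0 < δ) : IntegrableOn G (Ioi δ) := by
  refine (integrableOn_Ioi_continuous_smul (contDiff_cutoff M).continuous
    (fun r hr => cutoff_of_ge hr) hG hδ).congr_fun (fun r _ => ?_) measurableSet_Ioi
  rcases le_total r M with hr | hr
  · simp only [cutoff_of_le hr, one_smul]
  · simp only [hM r hr, smul_zero]

lemma exists_seq_continuous_tendsto_eLpNorm_sub {μ : Measure ℝ} [μ.Regular]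
    (hG : MemLp G 2 μ) (hM : ∀ r, M ≤ r → G r = 0) :
    ∃ k : ℕ → ℝ → E, (∀ n, Continuous (k n)) ∧ (∀ n r, M + 1 ≤ r → k n r = 0) ∧
      Filter.Tendsto (fun n => eLpNorm (k n - G) 2 μ) Filter.atTop (nhds 0) := by
  have happrox : ∀ n : ℕ, ∃ k : ℝ → E, Continuous k ∧
      eLpNorm (k - G) 2 μ ≤ ENNReal.ofReal (1 / ((n : ℝ) + 1)) := fun n => by
    obtain ⟨k, -, hkG, hk, -⟩ := hG.exists_hasCompactSupport_eLpNorm_sub_le ENNReal.ofNat_ne_top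
      (ε := ENNReal.ofReal (1 / ((n : ℝ) + 1))) (ENNReal.ofReal_pos.2 (by positivity)).ne'
    exact ⟨k, hk, by rwa [eLpNorm_sub_comm]⟩
  choose k hk hkG using happrox
  have hcut : ∀ n, eLpNorm ((fun r => cutoff M r • k n r) - G) 2 μ ≤ eLpNorm (k n - G) 2 μ := by
    refine fun n => eLpNorm_mono fun r => ?_
    simp only [Pi.sub_apply]
    rcases le_total r M with hr | hr
    · rw [cutoff_of_le hr, one_smul]
    · rw [hM r hr, sub_zero, sub_zero, norm_smul, Real.norm_eq_abs]
      exact mul_le_of_le_one_left (norm_nonneg _) (abs_cutoff_le M r)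
  refine ⟨fun n r => cutoff M r • k n r, fun n => (contDiff_cutoff M).continuous.smul (hk n),
    fun n r hr => by simp only [cutoff_of_ge hr, zero_smul], ?_⟩
  have hlim := ENNReal.tendsto_ofReal tendsto_one_div_add_atTop_nhds_zero_nat
  rw [ENNReal.ofReal_zero] at hlim
  exact tendsto_of_tendsto_of_tendsto_of_le_of_le tendsto_const_nhds hlim (fun _ => zero_le)
    fun n => (hcut n).trans (hkG n)

lemma hasDerivAt_neg_integral_Ioi [CompleteSpace E] {k : ℝ → E} (hk : Continuous k)
    (hM : ∀ r, M ≤ r → k r = 0) (r : ℝ) : HasDerivAt (fun s => -∫ t in Ioi s, k t) (k r) r := by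
  have hint : ∀ a, IntegrableOn k (Ioi a) := fun a => integrableOn_Ioi_of_continuous hk hM
  have hprim : (fun s => -∫ t in Ioi s, k t)
      = fun s => (∫ t in (0 : ℝ)..s, k t) - ∫ t in Ioi 0, k t := funext fun s => by
    rw [← intervalIntegral.integral_Ioi_sub_Ioi' (hint 0) (hint s), sub_sub_cancel_left]
  rw [hprim]
  exact (hk.integral_hasStrictDerivAt 0 r).hasDerivAt.sub_const _

lemma setIntegral_Ioi_eq_zero (hM : ∀ r, M ≤ r → G r = 0) {s : ℝ} (hs : M ≤ s) :
    ∫ r in Ioi s, G r = 0 :=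
  setIntegral_eq_zero_of_forall_eq_zero fun r (hr : r ∈ Ioi s) => hM r (hs.trans (le_of_lt hr))

lemma isRadialTrial_neg_integral_Ioi [CompleteSpace E] {k : ℝ → E} (hk : Continuous k)
    (hM : ∀ r, M ≤ r → k r = 0) : IsRadialTrial fun s => -∫ t in Ioi s, k t where
  contDiff := contDiff_one_iff_deriv.2
    ⟨fun r => (hasDerivAt_neg_integral_Ioi hk hM r).differentiableAt,
      by rwa [funext fun r => (hasDerivAt_neg_integral_Ioi hk hM r).deriv]⟩
  eventually_eq_zero := by
    filter_upwards [Filter.eventually_ge_atTop M] with s hs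
    rw [setIntegral_Ioi_eq_zero hM hs, neg_zero]

lemma eLpNorm_primitive_sub_le {k : ℝ → E} (hk : Continuous k) (hkM : ∀ r, M ≤ r → k r = 0)
    (hG : MemLp G 2 radialMeasure) (hGM : ∀ r, M ≤ r → G r = 0) :
    eLpNorm (fun s => (-∫ r in Ioi s, k r) - -∫ r in Ioi s, G r) 2 radialMeasure
      ≤ ENNReal.ofReal M * eLpNorm (k - G) 2 radialMeasure := by
  have hac : volume.restrict (Ioi 0) ≪ radialMeasure :=
    Measure.ae_le_iff_absolutelyContinuous.1 fun _ h => ae_radialMeasure_iff.1 h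
  refine le_trans (eLpNorm_mono_ae ?_) (eLpNorm_primitive_le
    (hk.aestronglyMeasurable.sub (hG.aestronglyMeasurable.mono_ac hac)) fun r hr => by
      rw [Pi.sub_apply, hkM r hr, hGM r hr, sub_zero])
  filter_upwards [ae_radialMeasure_pos] with s hs
  rw [← neg_sub', norm_neg]
  simp only [Pi.sub_apply]
  rw [integral_sub (integrableOn_Ioi_of_continuous hk hkM)
    (integrableOn_Ioi_of_memLp_radialMeasure hG hGM hs)]

end Approximation

section Density

/-- The triples `(f, f', (r - τ) f)` for the trial functions `f`, a dense part of the graph of the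
radial gradient. -/
def radialCore (τ : ℝ) : Set (L2r × L2r × L2r) :=
  {z | ∃ f : ℝ → ℂ, IsRadialTrial f ∧ z.1 =ᵐ[radialMeasure] f ∧
    z.2.1 =ᵐ[radialMeasure] deriv f ∧
    z.2.2 =ᵐ[radialMeasure] fun r => (r - τ) • f r}

lemma tendsto_toLp_of_ae_eq {F : ℕ → ℝ → ℂ} (hF : ∀ n, MemLp (F n) 2 radialMeasure) {v : L2r}
    {F₀ : ℝ → ℂ} (hv : v =ᵐ[radialMeasure] F₀)
    (h : Filter.Tendsto (fun n => eLpNorm (F n - F₀) 2 radialMeasure) Filter.atTop (nhds 0)) :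
    Filter.Tendsto (fun n => (hF n).toLp) Filter.atTop (nhds v) := by
  have hF₀ : MemLp F₀ 2 radialMeasure := (memLp_congr_ae hv).1 (Lp.memLp v)
  rw [show v = hF₀.toLp from Lp.ext (hv.trans hF₀.coeFn_toLp.symm)]
  exact (Lp.tendsto_Lp_iff_tendsto_eLpNorm'' _ hF _ hF₀).2 h

lemma tendsto_zero_of_le_ofReal_mul {a b : ℕ → ENNReal} {c : ℝ}
    (ha : Filter.Tendsto a Filter.atTop (nhds 0)) (hb : ∀ n, b n ≤ ENNReal.ofReal c * a n) :
    Filter.Tendsto b Filter.atTop (nhds 0) := by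
  have hlim := ENNReal.Tendsto.const_mul ha (Or.inr (ENNReal.ofReal_ne_top (r := c)))
  rw [mul_zero] at hlim
  exact tendsto_of_tendsto_of_tendsto_of_le_of_le tendsto_const_nhds hlim (fun _ => zero_le) hb

lemma eLpNorm_weight_smul_le {τ M : ℝ} {F : ℝ → ℂ} (hM : ∀ r, M ≤ r → F r = 0) :
    eLpNorm (fun r => (r - τ) • F r) 2 radialMeasure
      ≤ ENNReal.ofReal (M + |τ|) * eLpNorm F 2 radialMeasure := by
  refine eLpNorm_le_mul_eLpNorm_of_ae_le_mul ?_ 2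
  filter_upwards [ae_radialMeasure_pos] with r hr
  rw [norm_smul, Real.norm_eq_abs]
  rcases le_total r M with hrM | hrM
  · gcongr
    exact (abs_sub _ _).trans (by rw [abs_of_pos hr]; gcongr)
  · rw [hM r hrM, norm_zero, mul_zero, mul_zero]

lemma mem_closure_radialCore_of_ae_eq_primitive {τ M : ℝ} {u g p : L2r} {G : ℝ → ℂ}
    (hM : ∀ r, M ≤ r → G r = 0) (hu : u =ᵐ[radialMeasure] fun r => -∫ s in Ioi r, G s)
    (hg : g =ᵐ[radialMeasure] G) (hp : p =ᵐ[radialMeasure] fun r => (r - τ) • u r) :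
    (u, g, p) ∈ closure (radialCore τ) := by
  have hG : MemLp G 2 radialMeasure := (memLp_congr_ae hg).1 (Lp.memLp g)
  have hM' : ∀ r, M + 1 ≤ r → G r = 0 := fun r hr => hM r (by linarith)
  obtain ⟨k, hk, hkM, hkG⟩ := exists_seq_continuous_tendsto_eLpNorm_sub hG hM
  set f : ℕ → ℝ → ℂ := fun n s => -∫ r in Ioi s, k n r
  set F : ℝ → ℂ := fun s => -∫ r in Ioi s, G r
  have hf : ∀ n, IsRadialTrial (f n) := fun n => isRadialTrial_neg_integral_Ioi (hk n) (hkM n)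
  have hf' : ∀ n, deriv (f n) = k n := fun n =>
    funext fun r => (hasDerivAt_neg_integral_Ioi (hk n) (hkM n) r).deriv
  have hcont : ∀ n, Continuous (f n) := fun n => (hf n).contDiff.continuous
  have hfM : ∀ n r, M + 1 ≤ r → f n r = 0 := fun n r hr =>
    neg_eq_zero.2 (setIntegral_Ioi_eq_zero (hkM n) hr)
  have hFM : ∀ r, M + 1 ≤ r → F r = 0 := fun r hr =>
    neg_eq_zero.2 (setIntegral_Ioi_eq_zero hM' hr)
  have hf_mem := fun n => memLp_radialMeasure_of_continuous (hcont n) (hfM n) 2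
  have hk_mem := fun n => memLp_radialMeasure_of_continuous (hk n) (hkM n) 2
  have hw_mem : ∀ n, MemLp (fun r => (r - τ) • f n r) 2 radialMeasure := fun n =>
    memLp_radialMeasure_of_continuous (M := M + 1) (by fun_prop)
      (fun r hr => by rw [hfM n r hr, smul_zero]) 2
  have hfF : Filter.Tendsto (fun n => eLpNorm (f n - F) 2 radialMeasure) Filter.atTop (nhds 0) :=
    tendsto_zero_of_le_ofReal_mul hkG fun n => eLpNorm_primitive_sub_le (hk n) (hkM n) hG hM'
  have hwF : Filter.Tendsto (fun n => eLpNorm ((fun r => (r - τ) • f n r) - fun r => (r - τ) • F r)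
      2 radialMeasure) Filter.atTop (nhds 0) :=
    tendsto_zero_of_le_ofReal_mul hfF fun n => by
      refine le_trans (le_of_eq ?_) (eLpNorm_weight_smul_le (τ := τ) (M := M + 1)
        fun r hr => by rw [Pi.sub_apply, hfM n r hr, hFM r hr, sub_zero])
      simp only [Pi.sub_def, smul_sub]
  have hpF : p =ᵐ[radialMeasure] fun r => (r - τ) • F r := by
    filter_upwards [hu, hp] with r hur hpr
    rw [hpr, hur]
  refine mem_closure_of_tendsto ((tendsto_toLp_of_ae_eq hf_mem hu hfF).prodMk_nhds
    ((tendsto_toLp_of_ae_eq hk_mem hg hkG).prodMk_nhds (tendsto_toLp_of_ae_eq hw_mem hpF hwF)))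
    (.of_forall fun n => ⟨f n, hf n, (hf_mem n).coeFn_toLp, ?_, (hw_mem n).coeFn_toLp⟩)
  rw [hf']
  exact (hk_mem n).coeFn_toLp

lemma memLp_continuous_smul {c : ℝ → ℝ} (hc : Continuous c) {C : ℝ} (hC : ∀ r, |c r| ≤ C)
    (v : L2r) : MemLp (fun r => c r • v r) 2 radialMeasure :=
  (Lp.memLp v).of_le_mul (hc.aestronglyMeasurable.smul (Lp.aestronglyMeasurable v))
    (.of_forall fun r => by
      rw [norm_smul, Real.norm_eq_abs]
      exact mul_le_mul_of_nonneg_right (hC r) (norm_nonneg _))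

lemma mem_closure_radialCore {u g p : L2r} (hug : IsWeakDeriv u g) {τ : ℝ}
    (hp : p =ᵐ[radialMeasure] fun r => (r - τ) • u r) : (u, g, p) ∈ closure (radialCore τ) := by
  obtain ⟨C, hC⟩ := exists_abs_deriv_cutoff_le
  have hχ : ∀ (n : ℕ) (v : L2r), MemLp (fun r => cutoff n r • v r) 2 radialMeasure := fun n =>
    memLp_continuous_smul (contDiff_cutoff n).continuous (abs_cutoff_le n)
  have hχ' : ∀ n : ℕ, MemLp (fun r => deriv (cutoff n) r • u r) 2 radialMeasure := fun n =>
    memLp_continuous_smul ((contDiff_cutoff n).continuous_deriv (by simp)) (hC n) u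
  have hlim : ∀ v : L2r, Filter.Tendsto (fun n => (hχ n v).toLp) Filter.atTop (nhds v) :=
    fun v => by
      simpa only [one_smul] using tendsto_toLp_smul (fun n => abs_cutoff_le n)
        tendsto_cutoff_natCast v (hχ · v)
  have hlim' : Filter.Tendsto (fun n => (hχ n g).toLp + (hχ' n).toLp) Filter.atTop (nhds g) := by
    simpa only [zero_smul, add_zero] using (hlim g).add
      (tendsto_toLp_smul (fun n => hC n) tendsto_deriv_cutoff_natCast u hχ')
  refine isClosed_closure.mem_of_tendsto ((hlim u).prodMk_nhds (hlim'.prodMk_nhds (hlim p)))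
    (.of_forall fun n => mem_closure_radialCore_of_ae_eq_primitive (M := n + 2)
      (G := cutoffDeriv (cutoff n) u g) (fun r hr => ?_) ?_ ?_ ?_)
  · rw [cutoffDeriv, cutoff_of_ge (by linarith), zero_smul, zero_add,
      deriv_eq_zero_of_forall_ge (fun s hs => cutoff_of_ge hs) (by linarith), zero_smul]
  · exact (hχ n u).coeFn_toLp.trans
      (hug.ae_cutoff_eq_primitive (contDiff_cutoff n) fun r hr => cutoff_of_ge hr)
  · exact (Lp.coeFn_add _ _).trans ((hχ n g).coeFn_toLp.add (hχ' n).coeFn_toLp)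
  · filter_upwards [(hχ n p).coeFn_toLp, (hχ n u).coeFn_toLp, hp] with r hpr hur hr
    rw [hpr, hur, hr, smul_comm]

end Density

section Eigenvalue

variable {H K : Type*} [NormedAddCommGroup H] [InnerProductSpace ℂ H] [NormedAddCommGroup K]
  [InnerProductSpace ℂ K] {D : H → K → Prop} {t : ℝ}

lemma exists_norm_sq_eq_of_isEigenvalue (h : IsEigenvalue (FormOperator D) t) :
    ∃ u w, u ≠ 0 ∧ D u w ∧ ‖w‖ ^ 2 = t * ‖u‖ ^ 2 := by
  obtain ⟨u, hu, w, hw, h⟩ := h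
  refine ⟨u, w, hu, hw, ?_⟩
  have hinner := h u w hw
  rw [inner_smul_right, inner_self_eq_norm_sq_to_K, inner_self_eq_norm_sq_to_K] at hinner
  have : ((‖w‖ ^ 2 : ℝ) : ℂ) = (t * ‖u‖ ^ 2 : ℝ) := by
    push_cast
    exact hinner
  exact Complex.ofReal_injective this

lemma eigenvalue_nonneg (h : IsEigenvalue (FormOperator D) t) : 0 ≤ t := by
  obtain ⟨u, w, hu, -, h⟩ := exists_norm_sq_eq_of_isEigenvalue h
  exact nonneg_of_mul_nonneg_left (h ▸ sq_nonneg _) (pow_pos (norm_pos_iff.2 hu) 2)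

end Eigenvalue

section RadialEigenvalue

lemma norm_sq_eq_radialMass {u : L2r} {f : ℝ → ℂ} (h : u =ᵐ[radialMeasure] f) :
    ‖u‖ ^ 2 = radialMass f := by
  have hf : MemLp f 2 radialMeasure := (memLp_congr_ae h).1 (Lp.memLp u)
  rw [show u = hf.toLp from Lp.ext (h.trans hf.coeFn_toLp.symm), norm_toLp_sq,
    integral_radialMeasure, radialMass]

lemma IsRadialTrial.clm_comp {E F : Type*} [NormedAddCommGroup E] [NormedSpace ℝ E]
    [NormedAddCommGroup F] [NormedSpace ℝ F] {f : ℝ → E} (hf : IsRadialTrial f) (L : E →L[ℝ] F) :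
    IsRadialTrial fun r => L (f r) where
  contDiff := L.contDiff.comp hf.contDiff
  eventually_eq_zero := hf.eventually_eq_zero.mono fun r hr => by rw [hr, map_zero]

variable {f : ℝ → ℂ}

lemma IsRadialTrial.radialMass_eq_re_add_im (hf : IsRadialTrial f) :
    radialMass f = radialMass (fun r => (f r).re) + radialMass fun r => (f r).im := by
  have hre : IsRadialTrial fun r => (f r).re := hf.clm_comp Complex.reCLM
  have him : IsRadialTrial fun r => (f r).im := hf.clm_comp Complex.imCLM
  rw [radialMass, radialMass, radialMass,
    ← integral_add hre.integrableOn_mass him.integrableOn_mass]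
  refine integral_congr_ae (.of_forall fun r => ?_)
  simp only [Complex.sq_norm, Complex.normSq_apply, Real.norm_eq_abs, sq_abs]
  ring

lemma IsRadialTrial.radialEnergy_eq_re_add_im (hf : IsRadialTrial f) (τ : ℝ) :
    radialEnergy τ f
      = radialEnergy τ (fun r => (f r).re) + radialEnergy τ fun r => (f r).im := by
  have hd : ∀ r, HasDerivAt f (deriv f r) r := fun r =>
    (hf.contDiff.differentiable one_ne_zero r).hasDerivAt
  have hdre : ∀ r, deriv (fun r => (f r).re) r = (deriv f r).re := fun r =>
    (Complex.reCLM.hasFDerivAt.comp_hasDerivAt r (hd r)).deriv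
  have hdim : ∀ r, deriv (fun r => (f r).im) r = (deriv f r).im := fun r =>
    (Complex.imCLM.hasFDerivAt.comp_hasDerivAt r (hd r)).deriv
  have hre : IsRadialTrial fun r => (f r).re := hf.clm_comp Complex.reCLM
  have him : IsRadialTrial fun r => (f r).im := hf.clm_comp Complex.imCLM
  rw [radialEnergy, radialEnergy, radialEnergy,
    ← integral_add (hre.integrableOn_energy τ) (him.integrableOn_energy τ)]
  refine integral_congr_ae (.of_forall fun r => ?_)
  simp only [Complex.sq_norm, Complex.normSq_apply, hdre, hdim, Real.norm_eq_abs, sq_abs]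
  ring

lemma radialMass_deriv_add_radialMass_mul {τ : ℝ} (hf : IsRadialTrial f) :
    radialMass (deriv f) + radialMass (fun r => (r - τ) • f r) = radialEnergy τ f := by
  obtain ⟨M, -, hM⟩ := hf.exists_forall_ge
  have hcont := hf.contDiff.continuous
  have hderiv := hf.continuous_deriv
  rw [radialMass, radialMass, radialEnergy, ← integral_add
    (integrableOn_Ioi_of_continuous (M := M) (by fun_prop) fun r hr => by simp [hM r hr])
    (integrableOn_Ioi_of_continuous (M := M) (by fun_prop) fun r hr => by simp [hM r hr])]
  refine integral_congr_ae (.of_forall fun r => ?_)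
  simp only [norm_smul, mul_pow, Real.norm_eq_abs, sq_abs]
  ring

lemma radialEnergy_nonneg {E : Type*} [NormedAddCommGroup E] [NormedSpace ℝ E] (τ : ℝ)
    (f : ℝ → E) : 0 ≤ radialEnergy τ f :=
  setIntegral_nonneg measurableSet_Ioi fun r (hr : 0 < r) => by positivity

lemma exists_complex_trial_of_isEigenvalue {τ t : ℝ} (h : IsEigenvalue (RadialOperator τ) t)
    {s : ℝ} (hts : t < s) :
    ∃ f : ℝ → ℂ, IsRadialTrial f ∧ radialEnergy τ f < s * radialMass f := by
  obtain ⟨u, w, hu, ⟨hug, hp⟩, hw⟩ := exists_norm_sq_eq_of_isEigenvalue h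
  rw [PiLp.norm_sq_eq_of_L2, Fin.sum_univ_two] at hw
  have hopen : IsOpen {z : L2r × L2r × L2r | ‖z.2.1‖ ^ 2 + ‖z.2.2‖ ^ 2 < s * ‖z.1‖ ^ 2} :=
    isOpen_lt (by fun_prop) (by fun_prop)
  have hlt : ‖w 0‖ ^ 2 + ‖w 1‖ ^ 2 < s * ‖u‖ ^ 2 := by
    rw [hw]
    exact mul_lt_mul_of_pos_right hts (pow_pos (norm_pos_iff.2 hu) 2)
  obtain ⟨z, hz, f, hf, hzf, hzf', hzp⟩ :=
    mem_closure_iff.1 (mem_closure_radialCore hug hp) _ hopen hlt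
  refine ⟨f, hf, ?_⟩
  rwa [mem_ofPred_eq, norm_sq_eq_radialMass hzf, norm_sq_eq_radialMass hzf',
    norm_sq_eq_radialMass hzp, radialMass_deriv_add_radialMass_mul hf] at hz

lemma exists_real_trial_of_isEigenvalue {τ t : ℝ} (h : IsEigenvalue (RadialOperator τ) t)
    {s : ℝ} (hts : t < s) :
    ∃ f : ℝ → ℝ, IsRadialTrial f ∧ 0 < radialMass f ∧ radialEnergy τ f < s * radialMass f := by
  obtain ⟨f, hf, hlt⟩ := exists_complex_trial_of_isEigenvalue h hts
  have hs : 0 ≤ s := (eigenvalue_nonneg h).trans hts.le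
  suffices ∃ f : ℝ → ℝ, IsRadialTrial f ∧ radialEnergy τ f < s * radialMass f by
    obtain ⟨f, hf, hlt⟩ := this
    exact ⟨f, hf, pos_of_mul_pos_right ((radialEnergy_nonneg τ f).trans_lt hlt) hs, hlt⟩
  rw [hf.radialMass_eq_re_add_im, hf.radialEnergy_eq_re_add_im, mul_add] at hlt
  rcases lt_or_lt_of_add_lt_add hlt with hre | him
  · exact ⟨_, hf.clm_comp Complex.reCLM, hre⟩
  · exact ⟨_, hf.clm_comp Complex.imCLM, him⟩

end RadialEigenvalue

lemma Xi0_nonneg : 0 ≤ Xi0 :=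
  le_iInf fun _ => le_iInf₂ fun _ ht => EReal.coe_nonneg.2 (eigenvalue_nonneg ht)

/- Trial functions of energy below a fixed `q < 1` have a uniformly bounded moment; for larger
energies the explicit `radialBump` does the job. -/
lemma exists_forall_trial_of_Xi0_lt : ∃ κ, 0 ≤ κ ∧ ∀ s : ℝ, Xi0 < s →
    ∃ τ, ∃ f : ℝ → ℝ, IsRadialTrial f ∧ 0 < radialMass f ∧
      radialEnergy τ f / radialMass f ≤ s ∧ radialMoment f / radialMass f ≤ κ := by
  set q := radialEnergy (3 / 2) radialBump / radialMass radialBump with hq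
  have hmass : 0 < radialMass radialBump := by norm_num [radialMass_radialBump]
  have hq1 : q < 1 := by
    rw [hq, div_lt_one hmass, radialMass_radialBump]
    exact radialEnergy_radialBump_lt
  obtain ⟨κ, hκ, h⟩ :=
    exists_forall_radialMoment_le (div_nonneg (radialEnergy_nonneg _ _) hmass.le) hq1
  refine ⟨max κ (radialMoment radialBump / radialMass radialBump), le_max_of_le_left hκ,
    fun s hs => ?_⟩
  rcases le_or_gt q s with hqs | hqs
  · exact ⟨3 / 2, radialBump, isRadialTrial_radialBump, hmass, hqs, le_max_right _ _⟩
  · simp only [Xi0, zeta, firstEigenvalue, iInf_lt_iff, EReal.coe_lt_coe_iff] at hs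
    obtain ⟨τ, t, ht, hts⟩ := hs
    obtain ⟨f, hf, hf0, hlt⟩ := exists_real_trial_of_isEigenvalue ht hts
    have hmoment := h τ f hf (hlt.trans (mul_lt_mul_of_pos_right hqs hf0))
    exact ⟨τ, f, hf, hf0, (div_le_iff₀ hf0).2 hlt.le,
      ((div_le_iff₀ hf0).2 hmoment).trans (le_max_left _ _)⟩

section SmallOpening

lemma tan_le_two_mul {x : ℝ} (h0 : 0 ≤ x) (h1 : x ≤ 1) : Real.tan x ≤ 2 * x := by
  have hcos : 1 / 2 ≤ Real.cos x := by nlinarith [Real.one_sub_sq_div_two_le_cos (x := x)]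
  rw [Real.tan_eq_sin_div_cos, div_le_iff₀ (by linarith)]
  nlinarith [Real.sin_le h0]

lemma exists_groundEnergy_le_of_Xi0_lt {B : E3} (hB : 0 < B 1) : ∃ C, 0 ≤ C ∧
    ∀ A : E3 →L[ℝ] E3, (∀ x, curl A x = B) → ∀ α, 0 < α → α ≤ 2 →
      ∀ s : ℝ, Xi0 < s → groundEnergy A α ≤ ((B 1 * s + C * α ^ 2 : ℝ) : EReal) := by
  obtain ⟨κ, hκ, h⟩ := exists_forall_trial_of_Xi0_lt
  refine ⟨(B 0 ^ 2 + B 2 ^ 2) / (3 * B 1) * κ, by positivity, fun A hA α hα hα2 s hs => ?_⟩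
  obtain ⟨τ, f, hf, hmass, henergy, hmoment⟩ := h s hs
  have htan : 0 < Real.tan (α / 2) :=
    Real.tan_pos_of_pos_of_lt_pi_div_two (by linarith) (by linarith [Real.pi_gt_three])
  have htan_le : Real.tan (α / 2) ≤ α := by
    linarith [tan_le_two_mul (x := α / 2) (by linarith) (by linarith)]
  refine (groundEnergy_le_of_radial_trial hA hB htan τ hf hmass).trans (EReal.coe_le_coe ?_)
  calc B 1 * (radialEnergy τ f / radialMass f) + (B 0 ^ 2 + B 2 ^ 2) * Real.tan (α / 2) ^ 2
        / (3 * B 1) * (radialMoment f / radialMass f)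
      ≤ B 1 * s + (B 0 ^ 2 + B 2 ^ 2) * Real.tan (α / 2) ^ 2 / (3 * B 1) * κ := by gcongr
    _ ≤ B 1 * s + (B 0 ^ 2 + B 2 ^ 2) * α ^ 2 / (3 * B 1) * κ := by gcongr
    _ = B 1 * s + (B 0 ^ 2 + B 2 ^ 2) / (3 * B 1) * κ * α ^ 2 := by ring

end SmallOpening

section LargeOpening

lemma one_le_tan_half {α : ℝ} (h2 : 2 ≤ α) (hα : α < Real.pi) : 1 ≤ Real.tan (α / 2) := by
  rw [← Real.tan_pi_div_four]
  exact (Real.strictMonoOn_tan.le_iff_le ⟨by linarith [Real.pi_pos], by linarith [Real.pi_pos]⟩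
    ⟨by linarith [Real.pi_pos], by linarith⟩).2 (by linarith [Real.pi_le_four])

lemma closedBall_subset_wedge {α : ℝ} (h : 1 ≤ Real.tan (α / 2)) :
    Metric.closedBall (EuclideanSpace.single 0 2 : E3) (1 / 2) ⊆ wedge α := by
  intro x hx
  rw [mem_closedBall_iff_norm] at hx
  have h0 : |x 0 - 2| ≤ 1 / 2 := by simpa using (PiLp.norm_apply_le _ 0).trans hx
  have h1 : |x 1| ≤ 1 / 2 := by simpa using (PiLp.norm_apply_le _ 1).trans hx
  have h0' := (abs_le.1 h0).1
  change |x 1| < x 0 * Real.tan (α / 2)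
  nlinarith

lemma exists_groundEnergy_le_of_two_le (B : E3) : ∃ C : ℝ, ∀ A : E3 →L[ℝ] E3,
    (∀ x, curl A x = B) → ∀ α, 2 ≤ α → α < Real.pi → groundEnergy A α ≤ C := by
  let b : ContDiffBump (EuclideanSpace.single 0 2 : E3) :=
    ⟨1 / 4, 1 / 2, by norm_num, by norm_num⟩
  refine ⟨(∫ x, ∑ j, (partialDeriv j b x ^ 2 + refPotential B 0 x j ^ 2 * b x ^ 2))
    / ∫ x, b x ^ 2, fun A hA α h2 hα => ?_⟩
  have hsub : tsupport b ⊆ wedge α :=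
    b.tsupport_eq.trans_subset (closedBall_subset_wedge (one_le_tan_half h2 hα))
  have hb0 : ∀ x, x ∉ tsupport b → b x = 0 := fun x => image_eq_zero_of_notMem_tsupport
  have hmass : ∫ x in wedge α, b x ^ 2 = ∫ x, b x ^ 2 :=
    setIntegral_eq_integral_of_forall_compl_eq_zero fun x hx => by
      rw [hb0 x fun h => hx (hsub h), zero_pow two_ne_zero]
  have henergy :
      ∫ x in wedge α, ∑ j, (partialDeriv j b x ^ 2 + refPotential B 0 x j ^ 2 * b x ^ 2)
        = ∫ x, ∑ j, (partialDeriv j b x ^ 2 + refPotential B 0 x j ^ 2 * b x ^ 2) :=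
    setIntegral_eq_integral_of_forall_compl_eq_zero fun x hx => by
      simp [hb0 x fun h => hx (hsub h),
        partialDeriv_eq_zero_of_notMem_tsupport fun h => hx (hsub h)]
  have hpos : 0 < ∫ x, b x ^ 2 := by
    refine (b.continuous.pow 2).integral_pos_of_hasCompactSupport_nonneg_nonzero
      (b.hasCompactSupport.comp_left (g := (· ^ 2)) (zero_pow two_ne_zero))
      (fun _ => sq_nonneg _) (x := EuclideanSpace.single 0 2) (pow_ne_zero 2 ?_)
    rw [b.one_of_mem_closedBall (Metric.mem_closedBall_self b.rIn_pos.le)]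
    exact one_ne_zero
  rw [← hmass, ← henergy]
  exact groundEnergy_le_of_real_trial hA 0 b.contDiff b.hasCompactSupport.isCompact
    (fun x hx => hb0 x hx.2) (by rwa [hmass])

end LargeOpening

lemma le_coe_mul_add_of_forall_lt {E x : EReal} {b c : ℝ} (hb : 0 < b)
    (h : ∀ s : ℝ, x < s → E ≤ ((b * s + c : ℝ) : EReal)) : E ≤ b * x + c := by
  refine EReal.le_of_forall_lt_iff_le.1 fun z hz => ?_
  have hx : x < ((z - c) / b : ℝ) := by
    induction x with
    | bot => exact EReal.bot_lt_coe _
    | top => simp [EReal.coe_mul_top_of_pos hb] at hz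
    | coe x =>
      norm_cast at hz ⊢
      rw [lt_div_iff₀ hb]
      linarith
  simpa only [mul_div_cancel₀ _ hb.ne', sub_add_cancel] using h _ hx

end WedgeMagnetic

end

theorem proposition5p2_general (B : WedgeMagnetic.E3) (hB2 : 0 < B 1) :
    ∃ C : ℝ, 0 < C ∧
      ∀ A : WedgeMagnetic.E3 →L[ℝ] WedgeMagnetic.E3, (∀ x, WedgeMagnetic.curl A x = B) →
        ∀ α ∈ Set.Ioo (0 : ℝ) Real.pi,
          WedgeMagnetic.groundEnergy A α
            ≤ ((B 1 : ℝ) : EReal) * WedgeMagnetic.Xi0 + ((C * α ^ 2 : ℝ) : EReal) := by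
  obtain ⟨C₁, hC₁, hsmall⟩ := WedgeMagnetic.exists_groundEnergy_le_of_Xi0_lt hB2
  obtain ⟨C₂, hlarge⟩ := WedgeMagnetic.exists_groundEnergy_le_of_two_le B
  refine ⟨C₁ + |C₂| + 1, by positivity, fun A hA α hα =>
    WedgeMagnetic.le_coe_mul_add_of_forall_lt hB2 fun s hs => ?_⟩
  rcases le_total α 2 with h | h
  · refine (hsmall A hA α hα.1 h s hs).trans (EReal.coe_le_coe ?_)
    gcongr
    linarith [abs_nonneg C₂]
  · refine (hlarge A hA α h hα.2).trans (EReal.coe_le_coe ?_)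
    have hs0 : 0 ≤ s := (EReal.coe_pos.1 (WedgeMagnetic.Xi0_nonneg.trans_lt hs)).le
    calc C₂ ≤ |C₂| := le_abs_self C₂
      _ ≤ C₁ + |C₂| + 1 := by linarith
      _ ≤ (C₁ + |C₂| + 1) * α ^ 2 := le_mul_of_one_le_right (by positivity) (by nlinarith)
      _ ≤ B 1 * s + (C₁ + |C₂| + 1) * α ^ 2 := le_add_of_nonneg_left (by positivity)

theorem proposition5p2 (B : WedgeMagnetic.E3) (hB : ‖B‖ = 1) (hB2 : 0 < B 1) :
    ∃ C : ℝ, 0 < C ∧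
      ∀ A : WedgeMagnetic.E3 →L[ℝ] WedgeMagnetic.E3, (∀ x, WedgeMagnetic.curl A x = B) →
        ∀ α ∈ Set.Ioo (0 : ℝ) Real.pi,
          WedgeMagnetic.groundEnergy A α
            ≤ ((B 1 : ℝ) : EReal) * WedgeMagnetic.Xi0 + ((C * α ^ 2 : ℝ) : EReal) :=
  proposition5p2_general B hB2
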